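/- Let $L$ be a countable language extending the language of rings, let $\mathbb M$ be an $L$-structure expanding a field of characteristic $0$, let $T=\mathrm{Th}(\mathbb M)$ be its complete theory, and let $F=\mathrm{dcl}(\emptyset)\subseteq\mathbb M$ be the subfield of elements definable without parameters; $F$ is identified with $\mathrm{dcl}(\emptyset)$ in every model of $T$ (elements defined by the same formula correspond). Assume that $T$ is model complete and that $\mathbb M$ is algebraically bounded over $F$, i.e. in every structure $\mathbb N\equiv\mathbb M$ and for every $A\subseteq\mathbb N$, the model-theoretic algebraic closure $\mathrm{acl}(A)$ is the set of elements of $\mathbb N$ that are algebraic over the field $F(A)$. Let $\eta$ be a derivation on $F$. Let $T^\delta$ be the theory, in the language $L^\delta=L\cup\{\delta\}$ with a new unary function symbol $\delta$, consisting of $T$ together with axioms saying that $\delta$ is a derivation extending $\eta$. For a model $\mathbb K\models T$ with underlying field $K$, let $\mathrm{Der}_\eta(K)\subseteq K^K$ be the set of derivations on $K$ extending $\eta$, with the topology induced by the product topology on $K^K$, $K$ discrete. Let $\mathbb G\subseteq\mathrm{Der}_\eta(K)$ be the set of generic derivations: those $\delta$ such that $\langle\mathbb K,\delta\rangle\models T^\delta_g$,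 where $T^\delta_g$ is the model completion of $T^\delta$. (A model completion of a theory $U$ is a theory $U^*$ in the same language such that all models of $U^*$ are models of $U$, every model of $U$ embeds in a model of $U^*$, and any two models of $U^*$ containing a common model $A$ of $U$ are elementarily equivalent over $A$; it is unique up to logical equivalence.) Then: 1. There exists a countable model $\mathbb K\models T$ of infinite rank over $F$, i.e. containing an infinite set that is independent over $F$ with respect to $\mathrm{acl}$. 2. For every countable model $\mathbb K\models T$ of infinite rank over $F$, $\mathrm{Der}_\eta(K)$ is a Polish space and $\mathbb G$ is a dense $\mathcal G_\delta$ subset of it. -/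

import Mathlib

open FirstOrder FirstOrder.Language FirstOrder.Ring

namespace GenericDerivation

universe u v w

/-! ### Model-theoretic notions -/

section ModelTheory

variable (L : FirstOrder.Language.{u, v}) {M : Type w} [L.Structure M]

/-- The model-theoretic definable closure of a set `A` of parameters. -/
def dcl (A : Set M) : Set M := {b | A.Definable₁ L {b}}

/-- The model-theoretic algebraic closure of a set `A` of parameters: the union of all finite
`A`-definable subsets of the structure. -/
def acl (A : Set M) : Set M := {b | ∃ s : Set M, A.Definable₁ L s ∧ s.Finite ∧ b ∈ s}

/-- The set `A` is independent over `B` with respect to the closure operator `acl`. -/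
def AclIndependent (B A : Set M) : Prop := ∀ a ∈ A, a ∉ acl L (B ∪ A \ {a})

variable {L}

/-- The formula `φ(x)` (without parameters) defines the element `a` of the structure. -/
def Names (φ : L.Formula (Fin 1)) (a : M) : Prop :=
  ∀ x : M, φ.Realize (fun _ => x) ↔ x = a

/-- A theory is model complete if every embedding between two of its models is elementary. -/
def ModelComplete (T : L.Theory) : Prop :=
  ∀ (A B : Theory.ModelType.{u, v, w} T) (f : A ↪[L] B) (n : ℕ) (φ : L.Formula (Fin n))
    (a : Fin n → A), φ.Realize (f ∘ a) ↔ φ.Realize a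

/-- `U'` is a model completion of `U`: every model of `U'` is a model of `U`, every model of `U`
embeds in a model of `U'`, and any two models of `U'` containing a common model `A` of `U`
are elementarily equivalent over `A`. -/
structure IsModelCompletion (U U' : L.Theory) : Prop where
  model : ∀ B : Theory.ModelType.{u, v, w} U', B ⊨ U
  embeds : ∀ A : Theory.ModelType.{u, v, w} U,
    ∃ B : Theory.ModelType.{u, v, w} U', Nonempty (A ↪[L] B)
  complete : ∀ (A : Theory.ModelType.{u, v, w} U) (B C : Theory.ModelType.{u, v, w} U')
    (f : A ↪[L] B) (g : A ↪[L] C) (n : ℕ) (φ : L.Formula (Fin n)) (a : Fin n → A),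
    φ.Realize (f ∘ a) ↔ φ.Realize (g ∘ a)

end ModelTheory

/-! ### Expansions of fields -/

/-- The language of an expansion of a ring: the language of rings together with the further
symbols in `L'`. -/
abbrev fieldLang (L' : FirstOrder.Language.{0, 0}) : FirstOrder.Language.{0, 0} := FirstOrder.Language.ring.sum L'

section Fields

variable (L' : FirstOrder.Language.{0, 0})

variable {L'} in
theorem dcl_const {K : Type} [Field K] [CompatibleRing K] [L'.Structure K] {a : K}
    (ha : a ∈ dcl (fieldLang L') (∅ : Set K)) :
    (∅ : Set K).DefinableFun (fieldLang L') (fun _ : Fin 1 → K => a) := by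
  have h := Set.Definable.preimage_comp (fun _ : Fin 1 => (none : Option (Fin 1))) ha
  change (∅ : Set K).Definable (fieldLang L') _
  convert h using 1
  ext v
  simp [Function.tupleGraph, eq_comm]

variable {L'} in
theorem dcl_of_eq {K : Type} [Field K] [CompatibleRing K] [L'.Structure K] {a : K}
    {f g : (Fin 1 → K) → K} (hf : (∅ : Set K).DefinableFun (fieldLang L') f)
    (hg : (∅ : Set K).DefinableFun (fieldLang L') g)
    (h : ∀ x : Fin 1 → K, f x = g x ↔ x 0 = a) : a ∈ dcl (fieldLang L') (∅ : Set K) := by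
  have h1 := Set.DefinableFun.ofPred_eq hf hg
  have h2 : {x : Fin 1 → K | f x = g x} = {x : Fin 1 → K | x 0 ∈ ({a} : Set K)} := by
    ext x
    exact h x
  change (∅ : Set K).Definable (fieldLang L') {x : Fin 1 → K | x 0 ∈ ({a} : Set K)}
  rw [← h2]
  exact h1

variable {L'} in
theorem definable_fun_apply {K : Type} [Field K] [CompatibleRing K] [L'.Structure K] {n : ℕ}
    (s : FirstOrder.Language.ring.Functions n) {g : Fin n → (Fin 1 → K) → K}
    (hg : ∀ i, (∅ : Set K).DefinableFun (fieldLang L') (g i)) :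
    (∅ : Set K).DefinableFun (fieldLang L')
      (fun x => Structure.funMap s (fun i => g i x)) :=
  Set.DefinableFun.comp (L := fieldLang L') (g := fun x i => g i x) hg
    (Set.DefinableFun.fun_symbol (L := fieldLang L') (M := K) (Sum.inl s))

/-- The field `F = dcl(∅)` of elements definable without parameters. -/
def dclEmpty (K : Type) [Field K] [CompatibleRing K] [L'.Structure K] : Subfield K where
  carrier := dcl (fieldLang L') (∅ : Set K)
  mul_mem' := fun {a b} ha hb =>
    dcl_of_eq ((fieldLang L').definableFun_var 0)
      (definable_fun_apply mulFunc (g := ![fun _ => a, fun _ => b])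
        (by intro i; fin_cases i; exacts [dcl_const ha, dcl_const hb])) (by simp)
  one_mem' :=
    dcl_of_eq ((fieldLang L').definableFun_var 0)
      (definable_fun_apply oneFunc (g := ![]) (fun i => i.elim0)) (by simp)
  add_mem' := fun {a b} ha hb =>
    dcl_of_eq ((fieldLang L').definableFun_var 0)
      (definable_fun_apply addFunc (g := ![fun _ => a, fun _ => b])
        (by intro i; fin_cases i; exacts [dcl_const ha, dcl_const hb])) (by simp)
  zero_mem' :=
    dcl_of_eq ((fieldLang L').definableFun_var 0)
      (definable_fun_apply zeroFunc (g := ![]) (fun i => i.elim0)) (by simp)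
  neg_mem' := fun {a} ha =>
    dcl_of_eq ((fieldLang L').definableFun_var 0)
      (definable_fun_apply negFunc (g := ![fun _ => a])
        (by intro i; fin_cases i; exact dcl_const ha)) (by simp)
  inv_mem' := fun a ha => by
    by_cases h : a = 0
    · rw [h, inv_zero, ← h]
      exact ha
    · refine dcl_of_eq
        (definable_fun_apply mulFunc (g := ![fun _ => a, fun x => x 0])
          (by intro i; fin_cases i; exacts [dcl_const ha, (fieldLang L').definableFun_var 0]))
        (definable_fun_apply oneFunc (g := ![]) (fun i => i.elim0)) (fun x => ?_)
      simp only [CompatibleRing.funMap_mul, CompatibleRing.funMap_one, Matrix.cons_val_zero,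
        Matrix.cons_val_one]
      exact ⟨fun e => eq_inv_of_mul_eq_one_right e, fun e => by rw [e, mul_inv_cancel₀ h]⟩

/-- The expansion `M` of a field is algebraically bounded over `F = dcl(∅)`: in every structure `N`
elementarily equivalent to `M`, the model-theoretic algebraic closure of any set `A` consists of
the elements that are algebraic over the field generated by `dcl(∅)` and `A`. -/
def AlgebraicallyBounded (M : Type) [Field M] [CompatibleRing M] [L'.Structure M] : Prop :=
  ∀ (N : Type) [Field N] [CompatibleRing N] [L'.Structure N],
    N ⊨ (fieldLang L').completeTheory M → ∀ (A : Set N) (b : N),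
      b ∈ acl (fieldLang L') A ↔
        IsAlgebraic (Subfield.closure ((dclEmpty L' N : Set N) ∪ A)) b

/-- `K` has infinite rank over `F = dcl(∅)`, with respect to the matroid given by `acl`. -/
def HasInfiniteRank (K : Type) [Field K] [CompatibleRing K] [L'.Structure K] : Prop :=
  ∃ A : Set K, A.Infinite ∧ AclIndependent (fieldLang L') (dclEmpty L' K : Set K) A

end Fields

/-! ### Derivations -/

/-- One unary function symbol. -/
inductive DeltaFunc : ℕ → Type
  | delta : DeltaFunc 1

/-- The language whose only symbol is the unary function symbol `δ`. -/
def deltaLang : FirstOrder.Language.{0, 0} := ⟨DeltaFunc, fun _ => Empty⟩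

/-- The function symbol `δ`. -/
abbrev deltaSymbol : deltaLang.Functions 1 := DeltaFunc.delta

/-- The language `L^δ`. -/
abbrev diffLang (L' : FirstOrder.Language.{0, 0}) : FirstOrder.Language.{0, 0} := (fieldLang L').sum deltaLang

/-- The interpretation of the symbol `δ` by a given function. -/
@[reducible] def deltaStructure {K : Type} (δ : K → K) : deltaLang.Structure K where
  funMap := fun {_} f => match f with
    | .delta => fun x => δ (x 0)
  RelMap := fun {_} r => Empty.elim r

/-- `⟨K, δ⟩ ⊨ S`. -/
def ModelsWith {L' : FirstOrder.Language.{0, 0}} {K : Type} [(fieldLang L').Structure K] (δ : K → K)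
    (S : (diffLang L').Theory) : Prop :=
  letI := deltaStructure δ
  K ⊨ S

section DiffTheory

variable {L' : FirstOrder.Language.{0, 0}}

/-- The term `s + t`. -/
def addTerm {α : Type} (s t : (diffLang L').Term α) : (diffLang L').Term α :=
  Functions.apply₂ (LHom.sumInl.onFunction (LHom.sumInl.onFunction addFunc) :
    (diffLang L').Functions 2) s t

/-- The term `s * t`. -/
def mulTerm {α : Type} (s t : (diffLang L').Term α) : (diffLang L').Term α :=
  Functions.apply₂ (LHom.sumInl.onFunction (LHom.sumInl.onFunction mulFunc) :
    (diffLang L').Functions 2) s t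

/-- The term `δ t`. -/
def deltaTerm {α : Type} (t : (diffLang L').Term α) : (diffLang L').Term α :=
  Functions.apply₁ (LHom.sumInr.onFunction deltaSymbol : (diffLang L').Functions 1) t

/-- The sentence `∀ x₀ x₁, χ(x₀, x₁)`. -/
noncomputable def forallTwo (χ : (diffLang L').Formula (Fin 2)) : (diffLang L').Sentence :=
  Formula.iAlls (Fin 2) (χ.relabel (Sum.inr : Fin 2 → Empty ⊕ Fin 2))

/-- The sentence `∀ x y, δ(x + y) = δ x + δ y`. -/
noncomputable def addAxiom : (diffLang L').Sentence :=
  forallTwo (Term.equal (deltaTerm (addTerm (Term.var 0) (Term.var 1)))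
    (addTerm (deltaTerm (Term.var 0)) (deltaTerm (Term.var 1))))

/-- The sentence `∀ x y, δ(x * y) = x * δ y + y * δ x`. -/
noncomputable def leibnizAxiom : (diffLang L').Sentence :=
  forallTwo (Term.equal (deltaTerm (mulTerm (Term.var 0) (Term.var 1)))
    (addTerm (mulTerm (Term.var 0) (deltaTerm (Term.var 1)))
      (mulTerm (Term.var 1) (deltaTerm (Term.var 0)))))

/-- The sentence `∀ x y, φ(x) → ψ(y) → δ x = y`. -/
noncomputable def valueAxiom (φ ψ : (fieldLang L').Formula (Fin 1)) : (diffLang L').Sentence :=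
  forallTwo (((LHom.sumInl.onFormula φ).relabel (fun _ => (0 : Fin 2))).imp
    (((LHom.sumInl.onFormula ψ).relabel (fun _ => (1 : Fin 2))).imp
      (Term.equal (deltaTerm (Term.var 0)) (Term.var 1))))

variable (L') {M : Type} [Field M] [CompatibleRing M] [L'.Structure M]

/-- The theory `T^δ`, where `T` is the theory of `M`: the axioms of `T`, the axioms saying that `δ`
is a derivation, and, for each `a` in `F = dcl(∅)` defined by `φ` such that `η a` is defined by
`ψ`, the axiom saying that `δ` maps the element defined by `φ` to the element defined by `ψ`. -/
def diffTheory (η : Derivation ℤ (dclEmpty L' M) (dclEmpty L' M)) : (diffLang L').Theory :=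
  (LHom.sumInl : fieldLang L' →ᴸ diffLang L').onTheory ((fieldLang L').completeTheory M) ∪
    {addAxiom, leibnizAxiom} ∪
    {σ | ∃ (a : dclEmpty L' M) (φ ψ : (fieldLang L').Formula (Fin 1)),
      Names φ (a : M) ∧ Names ψ (η a : M) ∧ σ = valueAxiom φ ψ}

variable (K : Type) [Field K] [CompatibleRing K] [L'.Structure K]

/-- The derivations on a model `K` of the theory of `M` that extend the derivation `η` of
`F = dcl(∅)`, where the elements of `F` are identified with the elements of `K` defined by the
same formulas. -/
def DerExt (η : Derivation ℤ (dclEmpty L' M) (dclEmpty L' M)) : Type :=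
  {D : Derivation ℤ K K // ∀ (a : dclEmpty L' M) (φ ψ : (fieldLang L').Formula (Fin 1)) (x y : K),
    Names φ (a : M) → Names ψ (η a : M) → Names φ x → Names ψ y → D x = y}

/-- The topology induced by the product topology on `K^K`, where `K` is discrete. -/
instance (η : Derivation ℤ (dclEmpty L' M) (dclEmpty L' M)) :
    TopologicalSpace (DerExt L' K η) :=
  TopologicalSpace.induced (fun D : DerExt L' K η => (D.1 : K → K))
    (@Pi.topologicalSpace K (fun _ => K) (fun _ => ⊥))

variable {L' K}

/-- A derivation `δ` on `K` extending `η` is generic if `⟨K, δ⟩` is a model of the model completion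
`T^δ_g` of `T^δ` (a model completion is unique up to logical equivalence). -/
def IsGeneric {η : Derivation ℤ (dclEmpty L' M) (dclEmpty L' M)} (D : DerExt L' K η) : Prop :=
  ∃ Tg : (diffLang L').Theory,
    IsModelCompletion.{0, 0, 0} (diffTheory L' η) Tg ∧ ModelsWith (D.1 : K → K) Tg

end DiffTheory

end GenericDerivation

open GenericDerivation

/-! The plan is to axiomatise the generic derivations explicitly, prove by Baire category that they
form a dense Gδ, and then show that the axioms are the model completion. In that last step the
density result itself supplies the embeddings.

Algebraic boundedness turns `acl` into field-theoretic algebraic closure over F, which has the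
exchange property and bases (`algCl_eq_closure`). It also makes "infinite" first-order for definable
sets: in `Big`, X is big if every field element is a quotient of differences from X, and by
`big_of_infinite` every infinite definable set is big. The reason is that otherwise some (x, y) ↦ x
+ zy would embed X × X into the line, against exchange. Iterating gives the first-order notion
`Large`. A definable set containing a tuple independent over its parameters is large
(`large_of_seqIndependent`), and in infinite rank a large set contains tuples independent over any
given finite set (`exists_seqIndependent_of_large`).

`genericTheory` adds to T^δ, for every formula θ(p, x, y), the axiom: if {x : ∃ y, θ(p, x, y)} is
large, then θ(p, x, δx) has a solution. On a countable K each instance is an open condition on δ. It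
is dense because, in characteristic 0, a derivation can be altered arbitrarily on a tuple
independent over the finite set where it is to be preserved (`exists_derExt_eq_on_finite`). There
are countably many instances and the space is Polish, so Baire's theorem gives a dense Gδ
(`isGδ_and_dense_genericTheory`).

It remains to identify these derivations with the generic ones. Models of T^δ embed into models of
`genericTheory` by density on countable pieces followed by an ultraproduct
(`exists_embedding_genericTheory`). Equivalence over a common submodel is a back-and-forth between
ℵ₁-saturated models. Its extension step (`exists_extension_of_elementary`) matches a transcendence
basis using the axioms, and the derivation is then determined on everything algebraic over that
basis. Any other model completion gives the same generic derivations (`isGeneric_iff`). The model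
asked for in the first claim comes from Löwenheim–Skolem: go up to an uncountable model, then down
to a countable one containing infinitely many independent elements. -/

namespace GenericDerivation

/-! ### Realization of countable types and ultrapowers -/

section Saturation

/-- Every countable set of formulas, with parameters and in arbitrarily many variables, which is
finitely satisfiable in `N`, is satisfiable in `N`. -/
def RealizesCountableTypes (L : FirstOrder.Language.{0, 0}) (N : Type) [L.Structure N] : Prop :=
  ∀ (α β : Type) (p : ℕ → L.Formula (α ⊕ β)) (v : α → N),
    (∀ k, ∃ w : β → N, ∀ i < k, (p i).Realize (Sum.elim v w)) →
      ∃ w : β → N, ∀ i, (p i).Realize (Sum.elim v w)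

/-- The usual diagonal argument for ℵ₁-saturation of a nonprincipal ultrapower over ℕ.
Representatives are chosen coordinatewise, so the number of variables plays no role; only the set of
formulas has to be countable. -/
theorem realizesCountableTypes_product (L : FirstOrder.Language.{0, 0}) (N : Type) [L.Structure N]
    [Nonempty N] :
    RealizesCountableTypes L ((Filter.hyperfilter ℕ : Filter ℕ).Product (fun _ : ℕ => N)) := by
  classical
  intro α β p v h
  choose w hw using h
  have hv : ∀ a, ∃ f : ℕ → N, ((f : ∀ _ : ℕ, N) :
      (Filter.hyperfilter ℕ : Filter ℕ).Product (fun _ : ℕ => N)) = v a :=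
    fun a => Quotient.exists_rep _
  choose v' hv' using hv
  have hw0 : ∀ k b, ∃ f : ℕ → N, ((f : ∀ _ : ℕ, N) :
      (Filter.hyperfilter ℕ : Filter ℕ).Product (fun _ : ℕ => N)) = w k b :=
    fun k b => Quotient.exists_rep _
  choose w' hw' using hw0
  have key : ∀ (φ : L.Formula (α ⊕ β)) (u : β → ℕ → N),
      φ.Realize (Sum.elim v (fun b => ((u b : ∀ _ : ℕ, N) :
        (Filter.hyperfilter ℕ : Filter ℕ).Product (fun _ : ℕ => N)))) ↔
      ∀ᶠ n in (Filter.hyperfilter ℕ : Filter ℕ),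
        φ.Realize (Sum.elim (fun a => v' a n) (fun b => u b n)) := by
    intro φ u
    have e1 : Sum.elim v (fun b => ((u b : ∀ _ : ℕ, N) :
        (Filter.hyperfilter ℕ : Filter ℕ).Product (fun _ : ℕ => N))) =
        fun i => ((Sum.elim v' u i : ∀ _ : ℕ, N) :
          (Filter.hyperfilter ℕ : Filter ℕ).Product (fun _ : ℕ => N)) := by
      funext x
      cases x
      · exact (hv' _).symm
      · rfl
    have e2 : ∀ n, Sum.elim (fun a => v' a n) (fun b => u b n) =
        fun i => Sum.elim v' u i n := by
      intro n
      funext x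
      cases x <;> rfl
    simp only [e1, e2]
    exact Ultraproduct.realize_formula_cast φ (Sum.elim v' u)
  let good : ℕ → ℕ → Prop := fun n k =>
    ∀ i < k, (p i).Realize (Sum.elim (fun a => v' a n) (fun b => w' k b n))
  have hgood : ∀ k, ∀ᶠ n in (Filter.hyperfilter ℕ : Filter ℕ), good n k := by
    intro k
    have : ∀ i ∈ Finset.range k, ∀ᶠ n in (Filter.hyperfilter ℕ : Filter ℕ),
        (p i).Realize (Sum.elim (fun a => v' a n) (fun b => w' k b n)) := by
      intro i hi
      rw [← key]
      simpa only [hw'] using hw k i (Finset.mem_range.1 hi)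
    filter_upwards [(Filter.eventually_all_finset _).2 this] with n hn i hi
    exact hn i (Finset.mem_range.2 hi)
  -- At index n, use the witness for the longest initial segment of the type that it satisfies
  -- there. The cap n makes the maximum exist, and by Łoś this maximum exceeds any fixed i for
  -- almost all n.
  let K : ℕ → ℕ := fun n => Nat.findGreatest (good n) n
  refine ⟨fun b => ((fun n => w' (K n) b n : ∀ _ : ℕ, N) : _), fun i => ?_⟩
  rw [key]
  have hlarge : ∀ᶠ n in (Filter.hyperfilter ℕ : Filter ℕ), i + 1 ≤ n :=
    Filter.Tendsto.eventually_ge_atTop (Nat.hyperfilter_le_atTop) _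
  filter_upwards [hlarge, hgood (i + 1)] with n hn hg
  have h1 : good n (K n) := Nat.findGreatest_spec hn hg
  have h2 : i + 1 ≤ K n := Nat.le_findGreatest hn hg
  exact h1 i h2

theorem exists_elementaryEmbedding_realizesCountableTypes (L : FirstOrder.Language.{0, 0})
    (N : Type) [L.Structure N] [Nonempty N] :
    ∃ (N' : Type) (_ : L.Structure N') (_ : N ↪ₑ[L] N'), RealizesCountableTypes L N' := by
  refine ⟨_, inferInstance, ⟨fun x => ((fun _ => x : ∀ _ : ℕ, N) :
    (Filter.hyperfilter ℕ : Filter ℕ).Product (fun _ : ℕ => N)), fun n φ x => ?_⟩,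
    realizesCountableTypes_product L N⟩
  have := Ultraproduct.realize_formula_cast (u := Filter.hyperfilter ℕ)
    (M := fun _ : ℕ => N) φ (fun i _ => x i)
  simp only [Filter.eventually_const] at this
  exact this

theorem RealizesCountableTypes.exists_realize {L : FirstOrder.Language.{0, 0}} {N : Type}
    [L.Structure N] [Nonempty N] (h : RealizesCountableTypes L N) {α β : Type}
    {P : Set (L.Formula (α ⊕ β))} (hP : P.Countable) (v : α → N)
    (hfin : ∀ s : Finset (L.Formula (α ⊕ β)), ↑s ⊆ P →
      ∃ w : β → N, ∀ φ ∈ s, φ.Realize (Sum.elim v w)) :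
    ∃ w : β → N, ∀ φ ∈ P, φ.Realize (Sum.elim v w) := by
  classical
  rcases P.eq_empty_or_nonempty with rfl | hne
  · exact ⟨fun _ => Classical.arbitrary N, by simp⟩
  obtain ⟨f, rfl⟩ := hP.exists_eq_range hne
  obtain ⟨w, hw⟩ := h α β f v (fun k => by
    obtain ⟨w, hw⟩ := hfin ((Finset.range k).image f) (by
      intro x hx
      simp only [Finset.coe_image, Set.mem_image] at hx
      obtain ⟨i, -, rfl⟩ := hx
      exact ⟨i, rfl⟩)
    exact ⟨w, fun i hi => hw _ (Finset.mem_image_of_mem _ (Finset.mem_range.2 hi))⟩)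
  exact ⟨w, by rintro _ ⟨i, rfl⟩; exact hw i⟩

/-- If f enumerated the set, "φ(x) and x ≠ f i for all i" would be a finitely satisfiable countable
type, and a realization would escape the enumeration. -/
theorem RealizesCountableTypes.not_countable {L : FirstOrder.Language.{0, 0}} {N : Type}
    [L.Structure N] [Nonempty N] (h : RealizesCountableTypes L N) {α : Type}
    (φ : L.Formula (α ⊕ Unit)) (v : α → N)
    (hinf : {x : N | φ.Realize (Sum.elim v (fun _ => x))}.Infinite) :
    ¬ {x : N | φ.Realize (Sum.elim v (fun _ => x))}.Countable := by
  classical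
  intro hc
  obtain ⟨f, hf⟩ := hc.exists_eq_range hinf.nonempty
  let ψ : ℕ → L.Formula ((α ⊕ ℕ) ⊕ Unit) := fun i =>
    φ.relabel (Sum.map Sum.inl id) ⊓
      (Term.equal (Term.var (Sum.inr ())) (Term.var (Sum.inl (Sum.inr i)))).not
  have hψ : ∀ i (w : Unit → N), (ψ i).Realize (Sum.elim (Sum.elim v f) w) ↔
      φ.Realize (Sum.elim v w) ∧ w () ≠ f i := by
    intro i w
    simp only [ψ, Formula.realize_inf, Formula.realize_relabel, Formula.realize_not,
      Formula.realize_equal, Term.realize_var, Sum.elim_inl, Sum.elim_inr]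
    rw [show Sum.elim (Sum.elim v f) w ∘ Sum.map Sum.inl id = Sum.elim v w by
      ext x; cases x <;> rfl]
  obtain ⟨w, hw⟩ := h (α ⊕ ℕ) Unit ψ (Sum.elim v f) (fun k => by
    obtain ⟨x, hx, hx'⟩ := hinf.exists_notMem_finset ((Finset.range k).image f)
    refine ⟨fun _ => x, fun i hi => (hψ _ _).2 ⟨hx, fun e => hx' ?_⟩⟩
    rw [e]
    exact Finset.mem_image_of_mem _ (Finset.mem_range.2 hi))
  have h0 : w () ∈ Set.range f := by
    rw [← hf]
    exact ((hψ 0 w).1 (hw 0)).1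
  obtain ⟨i, hi⟩ := h0
  exact ((hψ i w).1 (hw i)).2 hi.symm

end Saturation

/-! ### Countable languages -/

section Countable

theorem card_le_aleph0 (L : FirstOrder.Language.{0, 0}) [Countable L.Symbols] :
    L.card ≤ Cardinal.aleph0 :=
  Cardinal.mk_le_aleph0 (α := L.Symbols)

theorem countable_formula (L : FirstOrder.Language.{0, 0}) [Countable L.Symbols] (α : Type)
    [Countable α] : Countable (L.Formula α) := by
  have h : Countable (Σ n, L.BoundedFormula α n) := by
    rw [← Cardinal.mk_le_aleph0_iff]
    refine BoundedFormula.card_le.trans (max_le le_rfl ?_)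
    simp only [Cardinal.lift_id]
    refine Cardinal.add_le_aleph0.2 ⟨Cardinal.mk_le_aleph0, ?_⟩
    exact Cardinal.mk_le_aleph0
  exact (sigma_mk_injective (β := fun n => L.BoundedFormula α n) (i := 0)).countable

theorem exists_countable_elementarySubstructure (L : FirstOrder.Language.{0, 0})
    [Countable L.Symbols] (N : Type) [L.Structure N] [Infinite N] {s : Set N}
    (hs : s.Countable) : ∃ S : L.ElementarySubstructure N, s ⊆ S ∧ Countable S := by
  obtain ⟨S, h1, h2⟩ := exists_elementarySubstructure_card_eq.{0, 0, 0, 0} L s Cardinal.aleph0 le_rfl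
    (by simpa using hs) (by simpa only [Cardinal.lift_le_aleph0, Cardinal.lift_aleph0] using card_le_aleph0 L)
    (by simp)
  refine ⟨S, h1, ?_⟩
  rw [← Cardinal.mk_le_aleph0_iff]
  simpa using h2.le

instance countable_symbols_sum (L₁ L₂ : FirstOrder.Language.{0, 0}) [Countable L₁.Symbols]
    [Countable L₂.Symbols] : Countable (L₁.sum L₂).Symbols := by
  rw [← Cardinal.mk_le_aleph0_iff]
  have : (L₁.sum L₂).card ≤ Cardinal.aleph0 := by
    rw [card_sum]
    simp only [Cardinal.lift_id]
    exact Cardinal.add_le_aleph0.2 ⟨card_le_aleph0 L₁, card_le_aleph0 L₂⟩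
  exact this

instance : Countable deltaLang.Symbols := by
  have : Countable (Σ n, deltaLang.Functions n) := by
    refine Function.Injective.countable (f := fun _ => ()) ?_
    rintro ⟨n, f⟩ ⟨m, g⟩ -
    cases f
    cases g
    rfl
  have h2 : IsEmpty (Σ n, deltaLang.Relations n) := ⟨fun x => Empty.elim x.2⟩
  exact instCountableSum

end Countable

/-! ### Models of `T` and `T^δ` as fields -/

section Decomposition

theorem structure_sum_eq {L₁ L₂ : FirstOrder.Language.{0, 0}} {N : Type}
    (S : (L₁.sum L₂).Structure N) :
    S = @sumStructure L₁ L₂ N (@LHom.reduct _ _ LHom.sumInl N S)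
      (@LHom.reduct _ _ LHom.sumInr N S) := by
  refine Structure.ext ?_ ?_
  · funext n f
    cases f <;> rfl
  · funext n f
    cases f <;> rfl

variable {L' : FirstOrder.Language.{0, 0}} {M : Type} [Field M] [CompatibleRing M] [L'.Structure M]

theorem model_of_completeTheory {L : FirstOrder.Language.{0, 0}} {A B : Type} [L.Structure A]
    [L.Structure B] (h : B ⊨ L.completeTheory A) (φ : L.Sentence) : B ⊨ φ ↔ A ⊨ φ := by
  have h1 : ∀ ψ : L.Sentence, A ⊨ ψ → B ⊨ ψ := fun ψ hψ =>
    h.realize_of_mem ψ (mem_completeTheory.2 hψ)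
  refine ⟨fun hB => ?_, h1 φ⟩
  by_contra hA
  exact (Formula.realize_not.1 (h1 φ.not (Formula.realize_not.2 hA))) hB

/-- The given structure is recovered up to equality, not just isomorphism, so an abstract model of T
can be replaced by an honest field expansion on the same carrier. -/
theorem exists_fieldStructure {N : Type} [S : (fieldLang L').Structure N]
    (h : N ⊨ (fieldLang L').completeTheory M) :
    ∃ (_ : Field N) (c : CompatibleRing N) (l : L'.Structure N),
      S = @sumStructure ring L' N c.toStructure l := by
  let r : ring.Structure N := (LHom.sumInl : ring →ᴸ fieldLang L').reduct N
  let l : L'.Structure N := (LHom.sumInr : L' →ᴸ fieldLang L').reduct N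
  have hS : S = @sumStructure ring L' N r l := structure_sum_eq (L₁ := ring) (L₂ := L') S
  have : N ⊨ Theory.field := by
    refine ⟨fun φ hφ => ?_⟩
    have h1 : M ⊨ (LHom.sumInl : ring →ᴸ fieldLang L').onSentence φ := by
      rw [LHom.realize_onSentence]
      exact Theory.realize_sentence_of_mem Theory.field hφ
    have h2 : N ⊨ (LHom.sumInl : ring →ᴸ fieldLang L').onSentence φ :=
      (model_of_completeTheory h _).2 h1
    rwa [LHom.realize_onSentence] at h2
  exact ⟨FirstOrder.Field.fieldOfModelField N, letI := FirstOrder.Field.fieldOfModelField N; FirstOrder.Field.compatibleRingOfModelField N, l, hS⟩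

theorem exists_diffStructure {N : Type} (S : (diffLang L').Structure N) :
    ∃ (S₀ : (fieldLang L').Structure N) (δ : N → N),
      S = @sumStructure (fieldLang L') deltaLang N S₀ (deltaStructure δ) := by
  refine ⟨@LHom.reduct _ _ LHom.sumInl N S, fun x =>
    @Structure.funMap _ N S 1 (LHom.sumInr.onFunction deltaSymbol) (fun _ => x), ?_⟩
  refine (structure_sum_eq S).trans ?_
  congr 1
  refine Structure.ext ?_ ?_
  · funext n f
    cases f
    funext x
    change @Structure.funMap _ N S 1 (LHom.sumInr.onFunction deltaSymbol) x =
      @Structure.funMap _ N S 1 (LHom.sumInr.onFunction deltaSymbol) (fun _ => x 0)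
    congr 1
    funext i
    rw [Subsingleton.elim i 0]
  · funext n f
    exact Empty.elim f

theorem charZero_of_model [CharZero M] {N : Type} [Field N] [CompatibleRing N] [L'.Structure N]
    (h : N ⊨ (fieldLang L').completeTheory M) : CharZero N := by
  refine charZero_of_inj_zero fun n hn => ?_
  by_contra hne
  let t : ring.Term Empty := termOfFreeCommRing (n : FreeCommRing Empty)
  have key : ∀ (R : Type) [Field R] [CompatibleRing R] [L'.Structure R],
      R ⊨ (LHom.sumInl : ring →ᴸ fieldLang L').onSentence (Term.equal t 0 : ring.Formula Empty) ↔
        (n : R) = 0 := by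
    intro R _ _ _
    rw [LHom.realize_onSentence]
    simp only [Sentence.Realize, Formula.realize_equal, t, realize_termOfFreeCommRing, map_natCast,
      realize_zero]
  have h2 := (key M).1 ((model_of_completeTheory h _).1 ((key N).2 hn))
  exact hne (Nat.cast_eq_zero.1 h2)

theorem infinite_of_model [CharZero M] {N : Type} [Field N] [CompatibleRing N] [L'.Structure N]
    (h : N ⊨ (fieldLang L').completeTheory M) : Infinite N :=
  haveI := charZero_of_model h
  Infinite.of_injective (Nat.cast : ℕ → N) Nat.cast_injective

theorem realize_forallTwo {N : Type} [(diffLang L').Structure N]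
    (χ : (diffLang L').Formula (Fin 2)) :
    N ⊨ forallTwo χ ↔ ∀ x y : N, χ.Realize ![x, y] := by
  simp only [forallTwo, Sentence.Realize, Formula.realize_iAlls, Formula.realize_relabel]
  refine ⟨fun h x y => h ![x, y], fun h i => ?_⟩
  convert h (i 0) (i 1) using 1
  funext j
  fin_cases j <;> rfl

section Delta

variable {N : Type} [Field N] [CompatibleRing N] [L'.Structure N] (δ : N → N)

theorem realize_addTerm {α : Type} (s t : (diffLang L').Term α) (v : α → N) :
    let _ := deltaStructure δ
    (addTerm s t).realize v = s.realize v + t.realize v := by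
  let _ := deltaStructure δ
  simp only [addTerm, Term.realize_functions_apply₂]
  change Structure.funMap addFunc _ = _
  simp

theorem realize_mulTerm {α : Type} (s t : (diffLang L').Term α) (v : α → N) :
    let _ := deltaStructure δ
    (mulTerm s t).realize v = s.realize v * t.realize v := by
  let _ := deltaStructure δ
  simp only [mulTerm, Term.realize_functions_apply₂]
  change Structure.funMap mulFunc _ = _
  simp

theorem realize_deltaTerm {α : Type} (t : (diffLang L').Term α) (v : α → N) :
    let _ := deltaStructure δ
    (deltaTerm t).realize v = δ (t.realize v) := by
  let _ := deltaStructure δ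
  simp only [deltaTerm, Term.realize_functions_apply₁]
  rfl

theorem realize_addAxiom :
    (let _ := deltaStructure δ; N ⊨ (addAxiom : (diffLang L').Sentence)) ↔
      ∀ x y : N, δ (x + y) = δ x + δ y := by
  let _ := deltaStructure δ
  simp only [addAxiom, realize_forallTwo, Formula.realize_equal, realize_addTerm,
    realize_deltaTerm, Term.realize_var, Matrix.cons_val_zero, Matrix.cons_val_one]

theorem realize_leibnizAxiom :
    (let _ := deltaStructure δ; N ⊨ (leibnizAxiom : (diffLang L').Sentence)) ↔
      ∀ x y : N, δ (x * y) = x * δ y + y * δ x := by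
  let _ := deltaStructure δ
  simp only [leibnizAxiom, realize_forallTwo, Formula.realize_equal, realize_addTerm,
    realize_deltaTerm, realize_mulTerm, Term.realize_var, Matrix.cons_val_zero,
    Matrix.cons_val_one]

theorem realize_valueAxiom (φ ψ : (fieldLang L').Formula (Fin 1)) :
    (let _ := deltaStructure δ; N ⊨ (valueAxiom φ ψ : (diffLang L').Sentence)) ↔
      ∀ x y : N, φ.Realize (fun _ => x) → ψ.Realize (fun _ => y) → δ x = y := by
  let _ := deltaStructure δ
  simp only [valueAxiom, realize_forallTwo, Formula.realize_imp, Formula.realize_relabel,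
    LHom.realize_onFormula, Formula.realize_equal, realize_deltaTerm, Term.realize_var,
    Matrix.cons_val_zero, Matrix.cons_val_one, Function.comp_def]

/-- Unique satisfiability is a sentence, hence decided by the complete theory. This is what
identifies dcl(∅) across models. -/
theorem realize_existsUnique_iff {A B : Type} [(fieldLang L').Structure A]
    [(fieldLang L').Structure B] (h : B ⊨ (fieldLang L').completeTheory A)
    (φ : (fieldLang L').Formula (Fin 1)) :
    (∃ b : B, Names φ b) ↔ ∃ a : A, Names φ a := by
  let σ : (fieldLang L').Sentence :=
    Formula.iExsUnique (Fin 1) (φ.relabel (Sum.inr : Fin 1 → Empty ⊕ Fin 1))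
  have key : ∀ (R : Type) [(fieldLang L').Structure R], R ⊨ σ ↔ ∃ b : R, Names φ b := by
    intro R _
    simp only [σ, Sentence.Realize, Formula.realize_iExsUnique, Formula.realize_relabel, Names]
    constructor
    · rintro ⟨x, hx, hx'⟩
      refine ⟨x 0, fun y => ⟨fun hy => congrFun (hx' (fun _ => y) hy) 0, ?_⟩⟩
      rintro rfl
      convert hx using 1
      funext i
      rw [Subsingleton.elim i 0]
      rfl
    · rintro ⟨b, hb⟩
      refine ⟨fun _ => b, (hb b).2 rfl, fun y hy => ?_⟩
      funext i
      refine (hb (y i)).1 ?_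
      convert hy using 1
      funext j
      rw [Subsingleton.elim i j]
      rfl
  rw [← key, ← key]
  exact model_of_completeTheory h σ

theorem names_of_realize {A B : Type} [(fieldLang L').Structure A]
    [(fieldLang L').Structure B] (h : B ⊨ (fieldLang L').completeTheory A)
    {φ : (fieldLang L').Formula (Fin 1)} {a : A} (ha : Names φ a) {b : B}
    (hb : φ.Realize (fun _ => b)) : Names φ b := by
  obtain ⟨b', hb'⟩ := (realize_existsUnique_iff h φ).2 ⟨a, ha⟩
  rwa [(hb' b).1 hb]

theorem modelsWith_diffTheory_iff {η : Derivation ℤ (dclEmpty L' M) (dclEmpty L' M)} :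
    ModelsWith δ (diffTheory L' η) ↔
      N ⊨ (fieldLang L').completeTheory M ∧ ∃ D : DerExt L' N η, (D.1 : N → N) = δ := by
  let _ := deltaStructure δ
  simp only [ModelsWith, diffTheory, Theory.model_union_iff, LHom.onTheory_model]
  constructor
  · rintro ⟨⟨h1, h2⟩, h3⟩
    refine ⟨h1, ?_⟩
    have hadd := (realize_addAxiom δ).1 (h2.realize_of_mem addAxiom (by simp))
    have hmul := (realize_leibnizAxiom δ).1 (h2.realize_of_mem leibnizAxiom (by simp))
    refine ⟨⟨Derivation.mk' (AddMonoidHom.mk' δ hadd).toIntLinearMap (fun x y => ?_), ?_⟩, rfl⟩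
    · simpa using hmul x y
    · intro a φ ψ x y ha hηa hx hy
      exact (realize_valueAxiom δ φ ψ).1 (h3.realize_of_mem _ ⟨a, φ, ψ, ha, hηa, rfl⟩) x y
        ((hx x).2 rfl) ((hy y).2 rfl)
  · rintro ⟨h1, D, rfl⟩
    refine ⟨⟨h1, ⟨?_⟩⟩, ⟨?_⟩⟩
    · intro φ hφ
      rcases hφ with rfl | rfl
      · exact (realize_addAxiom _).2 fun x y => map_add D.1 x y
      · exact (realize_leibnizAxiom _).2 fun x y => by simp
    · rintro _ ⟨a, φ, ψ, ha, hηa, rfl⟩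
      exact (realize_valueAxiom _ φ ψ).2 fun x y hx hy =>
        D.2 a φ ψ x y ha hηa (names_of_realize h1 ha hx) (names_of_realize h1 hηa hy)

end Delta

end Decomposition

/-! ### Algebraic closure inside a field -/

section AlgebraicClosure

variable {K : Type} [Field K]

/-- The elements of `K` that are algebraic over the field generated by `E` and `X`. -/
def algCl (E : Subfield K) (X : Set K) : Set K :=
  {b | IsAlgebraic (Subfield.closure ((E : Set K) ∪ X)) b}

/-- The matroid closure uses the subalgebra E[X]. Every element of the field E(X) is algebraic over
it, so both notions of algebraicity agree. Exchange, bases and equicardinality then come from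
matroid theory. -/
theorem algCl_eq_closure (E : Subfield K) (X : Set K) :
    algCl E X = (AlgebraicIndependent.matroid E K).closure X := by
  rw [AlgebraicIndependent.matroid_closure_eq]
  ext b
  simp only [algCl, Set.mem_ofPred_eq, SetLike.mem_coe, Subalgebra.mem_algebraicClosure]
  have hle : ∀ a : Algebra.adjoin E X, (a : K) ∈ Subfield.closure ((E : Set K) ∪ X) := by
    rintro ⟨a, ha⟩
    induction ha using Algebra.adjoin_induction with
    | mem x hx => exact Subfield.subset_closure (Or.inr hx)
    | algebraMap r => exact Subfield.subset_closure (Or.inl r.2)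
    | add x y _ _ hx hy => exact add_mem hx hy
    | mul x y _ _ hx hy => exact mul_mem hx hy
  let f : Algebra.adjoin E X →+* Subfield.closure ((E : Set K) ∪ X) :=
    { toFun := fun a => ⟨a, hle a⟩
      map_one' := rfl
      map_mul' := fun _ _ => rfl
      map_zero' := rfl
      map_add' := fun _ _ => rfl }
  have hf : Function.Injective f := fun a b h => Subtype.ext (congrArg
    (Subtype.val : Subfield.closure ((E : Set K) ∪ X) → K) h)
  let : Algebra (Algebra.adjoin E X) (Subfield.closure ((E : Set K) ∪ X)) := f.toAlgebra
  have : IsScalarTower (Algebra.adjoin E X) (Subfield.closure ((E : Set K) ∪ X)) K :=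
    IsScalarTower.of_algebraMap_eq (fun _ => rfl)
  have : Algebra.IsAlgebraic (Algebra.adjoin E X) (Subfield.closure ((E : Set K) ∪ X)) := by
    refine ⟨fun a => ?_⟩
    rw [← isAlgebraic_algebraMap_iff (A := K) Subtype.val_injective]
    obtain ⟨a, ha⟩ := a
    change IsAlgebraic _ a
    induction ha using Subfield.closure_induction with
    | mem x hx =>
      rcases hx with hx | hx
      · exact isAlgebraic_algebraMap (⟨x, (Algebra.adjoin E X).algebraMap_mem ⟨x, hx⟩⟩ :
          Algebra.adjoin E X)
      · exact isAlgebraic_algebraMap (⟨x, Algebra.subset_adjoin hx⟩ : Algebra.adjoin E X)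
    | one => exact isAlgebraic_one
    | add x y _ _ hx hy => exact hx.add hy
    | neg x _ hx => exact hx.neg
    | inv x _ hx => exact IsAlgebraic.inv_iff.2 hx
    | mul x y _ _ hx hy => exact hx.mul hy
  exact ⟨fun h => h.restrictScalars (Algebra.adjoin E X),
    fun h => h.extendScalars (S := Subfield.closure ((E : Set K) ∪ X)) hf⟩

theorem subset_algCl (E : Subfield K) (X : Set K) : X ⊆ algCl E X := by
  rw [algCl_eq_closure]
  exact Matroid.subset_closure _ _ (Set.subset_univ _)

theorem algCl_mono (E : Subfield K) {X Y : Set K} (h : X ⊆ Y) : algCl E X ⊆ algCl E Y := by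
  simp only [algCl_eq_closure]
  exact Matroid.closure_subset_closure _ h

theorem algCl_exchange (E : Subfield K) {X : Set K} {a b : K} (h : b ∈ algCl E (insert a X))
    (hb : b ∉ algCl E X) : a ∈ algCl E (insert b X) := by
  simp only [algCl_eq_closure] at *
  exact (Matroid.closure_exchange ⟨h, hb⟩).1

theorem countable_algCl {E : Subfield K} (hE : (E : Set K).Countable) {X : Set K}
    (hX : X.Countable) : (algCl E X).Countable := by
  have : Countable (Subfield.closure ((E : Set K) ∪ X)) := by
    rw [← Cardinal.mk_le_aleph0_iff]
    refine (Subfield.cardinalMk_closure_le_max _).trans (max_le ?_ le_rfl)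
    rw [Cardinal.le_aleph0_iff_set_countable]
    exact hE.union hX
  exact Algebraic.countable _ _

/-- The algebraic closure as a subfield. -/
def algClSubfield (E : Subfield K) (X : Set K) : Subfield K where
  carrier := algCl E X
  mul_mem' := fun ha hb => IsAlgebraic.mul ha hb
  one_mem' := isAlgebraic_one
  add_mem' := fun ha hb => IsAlgebraic.add ha hb
  zero_mem' := isAlgebraic_zero
  neg_mem' := fun ha => IsAlgebraic.neg ha
  inv_mem' := fun _ ha => IsAlgebraic.inv_iff.2 ha

theorem mem_algClSubfield {E : Subfield K} {X : Set K} {x : K} :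
    x ∈ algClSubfield E X ↔ x ∈ algCl E X := Iff.rfl

/-- An infinite independent set extends to a base and a finite spanning set contains one, but all
bases have the same cardinality. -/
theorem ne_univ_of_infinite_independent {E : Subfield K} {A : Set K} (hA : A.Infinite)
    (hind : ∀ a ∈ A, a ∉ algCl E (A \ {a})) {P : Set K} (hP : P.Finite) :
    ∃ x, x ∉ algCl E P := by
  by_contra! h
  have h1 : (AlgebraicIndependent.matroid E K).Indep A := by
    rw [Matroid.indep_iff_forall_notMem_closure_sdiff (hI := Set.subset_univ A)]
    intro a ha
    rw [← algCl_eq_closure]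
    exact hind a ha
  have h2 : (AlgebraicIndependent.matroid E K).Spanning P := by
    rw [Matroid.spanning_iff_closure_eq (hS := Set.subset_univ P), ← algCl_eq_closure]
    exact Set.eq_univ_of_forall h
  obtain ⟨B, hB, hAB⟩ := h1.exists_isBase_superset
  obtain ⟨B', hB', hBP⟩ := h2.exists_isBase_subset
  have h3 : B.encard = B'.encard := hB.encard_eq_encard_of_isBase hB'
  exact hA ((Set.finite_of_encard_eq_coe (k := B'.ncard) (by
    rw [h3, (hP.subset hBP).cast_ncard_eq])).subset hAB)

theorem exists_infinite_independent {E : Subfield K} (hE : (E : Set K).Countable)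
    (hK : ¬ Countable K) : ∃ A : Set K, A.Infinite ∧ ∀ a ∈ A, a ∉ algCl E (A \ {a}) := by
  obtain ⟨B, hB⟩ := (AlgebraicIndependent.matroid E K).exists_isBase
  refine ⟨B, fun hfin => hK ?_, ?_⟩
  · have h := countable_algCl hE hfin.countable
    rw [algCl_eq_closure, hB.closure_eq] at h
    exact Set.countable_univ_iff.1 h
  · intro a ha
    rw [algCl_eq_closure]
    exact hB.indep.notMem_closure_sdiff_of_mem ha

end AlgebraicClosure

/-! ### Extension and uniqueness of derivations -/

section DerivationExtension

/-- A derivation R → K is a ring homomorphism from R to the dual numbers K[ε] lifting R → K. Since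
K[ε] → K has square-zero kernel, formal smoothness lifts the identity of K to K[ε], and the ε-part
of the lift is the extension. -/
theorem exists_derivation_extension {R K : Type} [CommRing R] [Field K] [Algebra R K]
    [Algebra.FormallySmooth R K] (D : Derivation ℤ R K) :
    ∃ D' : Derivation ℤ K K, ∀ r, D' (algebraMap R K r) = D r := by
  let φ : R →+* TrivSqZeroExt K K :=
    { toFun := fun r => (algebraMap R K r, D r)
      map_one' := by
        refine TrivSqZeroExt.ext ?_ ?_
        · change algebraMap R K 1 = 1
          simp
        · change D 1 = 0
          simp
      map_mul' := fun x y => by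
        refine TrivSqZeroExt.ext ?_ ?_
        · change algebraMap R K (x * y) = algebraMap R K x * algebraMap R K y
          simp
        · change D (x * y) = algebraMap R K x * D y + MulOpposite.op (algebraMap R K y) • D x
          simp [Algebra.smul_def, mul_comm]
      map_zero' := by
        refine TrivSqZeroExt.ext ?_ ?_
        · change algebraMap R K 0 = 0
          simp
        · change D 0 = 0
          simp
      map_add' := fun x y => by
        refine TrivSqZeroExt.ext ?_ ?_
        · change algebraMap R K (x + y) = algebraMap R K x + algebraMap R K y
          simp
        · change D (x + y) = D x + D y
          simp }
  -- This algebra structure encodes D: an R-algebra section must restrict to D in its ε-part.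
  let : Algebra R (TrivSqZeroExt K K) := φ.toAlgebra
  let g : TrivSqZeroExt K K →ₐ[R] K :=
    { (TrivSqZeroExt.fstHom K K K).toRingHom with
      commutes' := fun r => rfl }
  have hg : Function.Surjective g := fun x => ⟨TrivSqZeroExt.inl x, rfl⟩
  have hnil : IsNilpotent (RingHom.ker (g : TrivSqZeroExt K K →+* K)) := by
    have hsq : RingHom.ker (g : TrivSqZeroExt K K →+* K) ^ 2 =
      RingHom.ker (g : TrivSqZeroExt K K →+* K) * RingHom.ker (g : TrivSqZeroExt K K →+* K) :=
      sq _
    refine ⟨2, hsq.trans ?_⟩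
    rw [Ideal.zero_eq_bot, eq_bot_iff, Ideal.mul_le]
    intro x hx y hy
    have hx' : x.fst = 0 := hx
    have hy' : y.fst = 0 := hy
    rw [Ideal.mem_bot]
    refine TrivSqZeroExt.ext ?_ ?_
    · simp [hx']
    · simp [hx', hy']
  let s := Algebra.FormallySmooth.liftOfSurjective (AlgHom.id R K) g hg hnil
  have hs : ∀ x, (s x).fst = x := fun x =>
    Algebra.FormallySmooth.liftOfSurjective_apply (AlgHom.id R K) g hg hnil x
  refine ⟨Derivation.mk' (AddMonoidHom.mk' (fun x => (s x).snd) (fun x y => by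
    rw [map_add, TrivSqZeroExt.snd_add])).toIntLinearMap (fun x y => ?_), fun r => ?_⟩
  · change (s (x * y)).snd = x • (s y).snd + y • (s x).snd
    rw [map_mul, TrivSqZeroExt.snd_mul, hs, hs]
    simp [mul_comm]
  · change (s (algebraMap R K r)).snd = D r
    rw [AlgHom.commutes]
    rfl

/-- K is algebraic over the field generated by a transcendence basis, and this algebraic step is
separable in characteristic 0. -/
theorem formallySmooth_of_charZero (E K : Type) [Field E] [Field K] [CharZero E] [Algebra E K] :
    Algebra.FormallySmooth E K := by
  obtain ⟨s, hs⟩ := exists_isTranscendenceBasis E K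
  have halg := hs.isAlgebraic_field
  have : Algebra.IsSeparable (IntermediateField.adjoin E (Set.range ((↑) : s → K))) K :=
    inferInstance
  exact Algebra.FormallySmooth.of_algebraicIndependent_of_isSeparable hs.1

open Polynomial in
-- Transcendence makes E[X] → K injective, so d/dX is a derivation on a subring of K. It extends
-- because K is formally smooth over E[X], by way of the localization E(X).
theorem exists_derivation_of_transcendental {K : Type} [Field K] [CharZero K] (E : Subfield K)
    {x : K} (hx : Transcendental E x) :
    ∃ D : Derivation ℤ K K, (∀ e ∈ E, D e = 0) ∧ D x = 1 := by
  let f : E[X] →ₐ[E] K := aeval x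
  have hf : Function.Injective f := transcendental_iff_injective.1 hx
  let : Algebra E[X] K := f.toRingHom.toAlgebra
  have hmap : ∀ p : E[X], algebraMap E[X] K p = aeval x p := fun _ => rfl
  let : Algebra (RatFunc E) K :=
    (IsFractionRing.lift (A := E[X]) (K := RatFunc E) (g := algebraMap E[X] K) hf).toAlgebra
  have : IsScalarTower E[X] (RatFunc E) K := IsScalarTower.of_algebraMap_eq fun p =>
    (IsFractionRing.lift_algebraMap (A := E[X]) (K := RatFunc E) (g := algebraMap E[X] K) hf p).symm
  have : CharZero (RatFunc E) := charZero_of_injective_algebraMap (R := E)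
    (algebraMap E (RatFunc E)).injective
  have : Algebra.FormallySmooth E[X] (RatFunc E) := .of_isLocalization (nonZeroDivisors _)
  have := formallySmooth_of_charZero (RatFunc E) K
  have : Algebra.FormallySmooth E[X] K := .comp _ (RatFunc E) _
  let D₀ : Derivation ℤ E[X] K := Derivation.mk' (AddMonoidHom.mk' (fun p : E[X] =>
    aeval x (derivative p)) (fun p q => by simp)).toIntLinearMap (fun p q => by
      change aeval x (derivative (p * q)) =
        aeval x p * aeval x (derivative q) + aeval x q * aeval x (derivative p)
      simp only [derivative_mul, map_add, map_mul]
      ring)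
  obtain ⟨D, hD⟩ := exists_derivation_extension D₀
  refine ⟨D, fun e he => ?_, ?_⟩
  · have := hD (C ⟨e, he⟩)
    rw [hmap, aeval_C] at this
    refine this.trans ?_
    change aeval x (derivative (C _)) = 0
    simp
  · have := hD X
    rw [hmap, aeval_X] at this
    refine this.trans ?_
    change aeval x (derivative X) = 1
    simp

theorem exists_derivation_of_subfield {E K : Type} [Field E] [Field K] [CharZero E] (i : E →+* K)
    (D : Derivation ℤ E E) : ∃ D' : Derivation ℤ K K, ∀ e, D' (i e) = i (D e) := by
  let := i.toAlgebra
  have := formallySmooth_of_charZero E K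
  let D₀ : Derivation ℤ E K := Derivation.mk' (AddMonoidHom.mk' (fun p : E =>
    i (D p)) (fun p q => by simp)).toIntLinearMap (fun p q => by
      change i (D (p * q)) = i p * i (D q) + i q * i (D p)
      simp)
  exact exists_derivation_extension D₀

open Polynomial in
/-- Two additive maps satisfying the Leibniz rule along a ring homomorphism agree on all elements
that are algebraic over the set where they agree. -/
theorem derivation_eq_of_isAlgebraic {R C : Type} [Field R] [CharZero R] [Field C] (h : R →+* C)
    (D₁ D₂ : R → C) (hD₁ : ∀ x y, D₁ (x + y) = D₁ x + D₁ y)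
    (hD₁' : ∀ x y, D₁ (x * y) = h x * D₁ y + h y * D₁ x)
    (hD₂ : ∀ x y, D₂ (x + y) = D₂ x + D₂ y)
    (hD₂' : ∀ x y, D₂ (x * y) = h x * D₂ y + h y * D₂ x) (E : Subfield R) (X : Set R)
    (hE : ∀ x ∈ E, D₁ x = D₂ x) (hX : ∀ x ∈ X, D₁ x = D₂ x) {r : R} (hr : r ∈ algCl E X) :
    D₁ r = D₂ r := by
  let := h.toAlgebra
  let d₁ : Derivation ℤ R C := Derivation.mk' (AddMonoidHom.mk' D₁ hD₁).toIntLinearMap hD₁'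
  let d₂ : Derivation ℤ R C := Derivation.mk' (AddMonoidHom.mk' D₂ hD₂).toIntLinearMap hD₂'
  let D : Derivation ℤ R C := d₁ - d₂
  have hD : ∀ x, D x = 0 ↔ D₁ x = D₂ x := fun x => sub_eq_zero
  let S : Subfield R :=
    { carrier := {x | D x = 0}
      mul_mem' := fun {a b} ha hb => by
        change D (a * b) = 0
        rw [D.leibniz, show D a = 0 from ha, show D b = 0 from hb]
        simp
      one_mem' := D.map_one_eq_zero
      add_mem' := fun {a b} ha hb => by
        change D (a + b) = 0
        rw [map_add, show D a = 0 from ha, show D b = 0 from hb, add_zero]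
      zero_mem' := map_zero D
      neg_mem' := fun {a} ha => by
        change D (-a) = 0
        rw [map_neg, show D a = 0 from ha, neg_zero]
      inv_mem' := fun a ha => by
        change D a⁻¹ = 0
        rw [D.leibniz_inv, show D a = 0 from ha, smul_zero] }
  have hS : ∀ s : S, D s = 0 := fun s => s.2
  have hle : Subfield.closure ((E : Set R) ∪ X) ≤ S := by
    rw [Subfield.closure_le]
    rintro x (hx | hx)
    · exact (hD x).2 (hE x hx)
    · exact (hD x).2 (hX x hx)
  have halg : IsAlgebraic S r := by
    let := (Subfield.inclusion hle).toAlgebra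
    have : IsScalarTower (Subfield.closure ((E : Set R) ∪ X)) S R :=
      IsScalarTower.of_algebraMap_eq (fun _ => rfl)
    exact IsAlgebraic.tower_top S (K := Subfield.closure ((E : Set R) ∪ X)) hr
  rw [← hD]
  -- Chain rule: the coefficients lie in S, where D vanishes. Applied to the minimal polynomial,
  -- which is separable, it forces D r = 0.
  have hp : ∀ p : S[X], D (aeval r p) = aeval r (derivative p) • D r := by
    intro p
    induction p using Polynomial.induction_on' with
    | add p q hp hq => simp only [map_add, hp, hq, add_smul]
    | monomial n a =>
      rw [aeval_monomial, D.leibniz, D.leibniz_pow, derivative_monomial, aeval_monomial]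
      have : D (algebraMap S R a) = 0 := hS a
      rw [this, smul_zero, add_zero, ← Nat.cast_smul_eq_nsmul R n, ← mul_smul, ← mul_smul]
      congr 1
  have hne : aeval r (derivative (minpoly S r)) ≠ 0 :=
    (minpoly.irreducible halg.isIntegral).separable.aeval_derivative_ne_zero (minpoly.aeval S r)
  have h0 := hp (minpoly S r)
  rw [minpoly.aeval, map_zero] at h0
  rw [Algebra.smul_def] at h0
  refine (mul_eq_zero.1 h0.symm).resolve_left fun h1 => hne ?_
  exact (map_eq_zero_iff h h.injective).1 h1

end DerivationExtension

/-! ### Largeness of definable sets -/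

section Large

/-- Every element of the field is a quotient of differences of elements of `X`. For definable sets
in models of an algebraically bounded theory this expresses that `X` is infinite. -/
def Big {K : Type} [Field K] (X : Set K) : Prop :=
  ∀ z : K, ∃ x : Fin 4 → K, (∀ i, x i ∈ X) ∧ x 2 ≠ x 3 ∧ z * x 2 + x 1 = z * x 3 + x 0

theorem Big.not_subset {K : Type} [Field K] {X : Set K} (h : Big X) {E : Subfield K} {b : K}
    (hb : b ∉ E) : ∃ x ∈ X, x ∉ E := by
  by_contra! hX
  obtain ⟨x, hx, hne, he⟩ := h b
  have h1 : b = (x 0 - x 1) / (x 2 - x 3) := by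
    rw [eq_div_iff (sub_ne_zero.2 hne)]
    linear_combination he
  refine hb ?_
  rw [h1]
  exact div_mem (sub_mem (hX _ (hx 0)) (hX _ (hx 1))) (sub_mem (hX _ (hx 2)) (hX _ (hx 3)))

/-- Iterated largeness: there are many first coordinates such that there are many second
coordinates, and so on, such that the tuple belongs to `X`. -/
def Large {K : Type} [Field K] : ∀ n : ℕ, Set (Fin n → K) → Prop
  | 0, X => (fun i => i.elim0) ∈ X
  | n + 1, X => Large n {x | Big {y | (Fin.snoc x y : Fin (n + 1) → K) ∈ X}}

variable {L' : FirstOrder.Language.{0, 0}}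

/-- The formula expressing that the set defined by `φ` is big. -/
noncomputable def bigFormula {γ : Type} (φ : (fieldLang L').Formula (γ ⊕ Unit)) :
    (fieldLang L').Formula γ :=
  let ψ : Fin 4 → (fieldLang L').Formula ((γ ⊕ Unit) ⊕ Fin 4) := fun i =>
    φ.relabel (Sum.elim (fun g => Sum.inl (Sum.inl g)) (fun _ => Sum.inr i))
  let X : Fin 4 → ring.Term ((γ ⊕ Unit) ⊕ Fin 4) := fun i => Term.var (Sum.inr i)
  let z : ring.Term ((γ ⊕ Unit) ⊕ Fin 4) := Term.var (Sum.inl (Sum.inr ()))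
  Formula.iAlls Unit (Formula.iExs (Fin 4)
    ((ψ 0 ⊓ ψ 1 ⊓ ψ 2 ⊓ ψ 3) ⊓ ((LHom.sumInl : ring →ᴸ fieldLang L').onFormula
      ((Term.equal (X 2) (X 3)).not ⊓ Term.equal (z * X 2 + X 1) (z * X 3 + X 0)))))

/-- The formula expressing that the set defined by `φ` is large. -/
noncomputable def largeFormula {γ : Type} :
    ∀ n : ℕ, (fieldLang L').Formula (γ ⊕ Fin n) → (fieldLang L').Formula γ
  | 0, φ => φ.relabel (Sum.elim id (fun i => i.elim0))
  | n + 1, φ => largeFormula n (bigFormula (φ.relabel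
      (Sum.elim (fun g => Sum.inl (Sum.inl g))
        (Fin.lastCases (Sum.inr ()) (fun i => Sum.inl (Sum.inr i))))))

theorem elim_snoc_eq {N γ : Type} (n : ℕ) (v : γ → N) (x : Fin n → N) (y : N) :
    Sum.elim (Sum.elim v x) (fun _ : Unit => y) ∘
      Sum.elim (fun g => Sum.inl (Sum.inl g))
        (Fin.lastCases (Sum.inr ()) (fun i => Sum.inl (Sum.inr i))) =
      Sum.elim v (Fin.snoc x y : Fin (n + 1) → N) := by
  funext j
  cases j with
  | inl g => rfl
  | inr i =>
    refine Fin.lastCases ?_ (fun i => ?_) i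
    · simp
    · simp

section Realize

variable {N : Type} [Field N] [CompatibleRing N] [L'.Structure N]

theorem realize_bigFormula {γ : Type} (φ : (fieldLang L').Formula (γ ⊕ Unit)) (v : γ → N) :
    (bigFormula φ).Realize v ↔ Big {x : N | φ.Realize (Sum.elim v (fun _ => x))} := by
  have h : ∀ (u : Unit → N) (x : Fin 4 → N) (i : Fin 4),
      Sum.elim (Sum.elim v u) x ∘ Sum.elim (fun g => Sum.inl (Sum.inl g)) (fun _ : Unit => Sum.inr i) =
        Sum.elim v (fun _ => x i) := by
    intro u x i
    funext j
    cases j <;> rfl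
  simp only [bigFormula, Formula.realize_iAlls, Formula.realize_iExs, Formula.realize_inf,
    Formula.realize_relabel, LHom.realize_onFormula, Formula.realize_not, Formula.realize_equal,
    Term.realize_var, realize_add, realize_mul, h, Sum.elim_inl, Sum.elim_inr, Big]
  constructor
  · intro H z
    obtain ⟨x, h1, h2, h3⟩ := H (fun _ => z)
    refine ⟨x, fun i => ?_, h2, h3⟩
    fin_cases i
    exacts [h1.1.1.1, h1.1.1.2, h1.1.2, h1.2]
  · intro H z
    obtain ⟨x, h1, h2, h3⟩ := H (z ())
    exact ⟨x, ⟨⟨⟨h1 0, h1 1⟩, h1 2⟩, h1 3⟩, h2, h3⟩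

theorem realize_largeFormula {γ : Type} : ∀ (n : ℕ) (φ : (fieldLang L').Formula (γ ⊕ Fin n))
    (v : γ → N),
    (largeFormula n φ).Realize v ↔ Large n {x : Fin n → N | φ.Realize (Sum.elim v x)}
  | 0, φ, v => by
    rw [largeFormula, Formula.realize_relabel]
    change _ ↔ φ.Realize _
    rw [iff_iff_eq]
    congr 1
    funext j
    rcases j with j | j
    · rfl
    · exact j.elim0
  | n + 1, φ, v => by
    rw [largeFormula, realize_largeFormula n]
    simp only [realize_bigFormula, Formula.realize_relabel, elim_snoc_eq]
    rfl

end Realize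

variable {M : Type} [Field M] [CompatibleRing M] [L'.Structure M]

/-- The solution set is finite and definable over the range of v, so it lies in `acl`, which
boundedness makes field-theoretic. -/
theorem mem_algCl_of_finite (hbdd : AlgebraicallyBounded L' M) {N : Type} [Field N]
    [CompatibleRing N] [L'.Structure N] (hN : N ⊨ (fieldLang L').completeTheory M) {α : Type}
    (φ : (fieldLang L').Formula (α ⊕ Unit)) (v : α → N)
    (hfin : {x : N | φ.Realize (Sum.elim v (fun _ => x))}.Finite) {b : N}
    (hb : φ.Realize (Sum.elim v (fun _ => b))) : b ∈ algCl (dclEmpty L' N) (Set.range v) := by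
  refine (hbdd N hN (Set.range v) b).1 ⟨_, ?_, hfin, hb⟩
  change (Set.range v).Definable (fieldLang L') _
  rw [Set.definable_iff_exists_formula_sum]
  refine ⟨φ.relabel (Sum.map (Set.rangeFactorization v) (fun _ => 0)), ?_⟩
  ext x
  simp only [Set.mem_ofPred_eq, Formula.realize_relabel]
  rw [iff_iff_eq]
  congr 1
  funext j
  cases j <;> rfl

theorem countable_dclEmpty [Countable L'.Symbols] (N : Type) [Field N] [CompatibleRing N]
    [L'.Structure N] : (dclEmpty L' N : Set N).Countable := by
  have h : ∀ a : dclEmpty L' N, ∃ φ : (fieldLang L').Formula (Fin 1), Names φ (a : N) := by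
    rintro ⟨a, ha⟩
    obtain ⟨φ, hφ⟩ := Set.empty_definable_iff.1 ha
    refine ⟨φ, fun x => ?_⟩
    have := Set.ext_iff.1 hφ (fun _ => x)
    exact this.symm
  choose f hf using h
  have : Countable ((fieldLang L').Formula (Fin 1)) := countable_formula _ _
  refine (Function.Injective.countable (f := f) fun a b hab => ?_)
  have := (hf a b).1 (by rw [hab]; exact (hf b b).2 rfl)
  exact Subtype.ext this.symm

/-- A dimension count. If z is not a quotient of differences, then (x, y) ↦ x + zy is injective on X
× X. Two independent elements x, y of X would then be algebraic over the single element w = x + zy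
and the parameters, which exchange forbids. -/
theorem big_of_infinite_of_realizesCountableTypes [Countable L'.Symbols]
    (hbdd : AlgebraicallyBounded L' M) {N : Type} [Field N]
    [CompatibleRing N] [L'.Structure N] (hN : N ⊨ (fieldLang L').completeTheory M)
    (hsat : RealizesCountableTypes (fieldLang L') N) {α : Type} [Countable α]
    (φ : (fieldLang L').Formula (α ⊕ Unit)) (v : α → N)
    (hinf : {x : N | φ.Realize (Sum.elim v (fun _ => x))}.Infinite) :
    Big {x : N | φ.Realize (Sum.elim v (fun _ => x))} := by
  set X := {x : N | φ.Realize (Sum.elim v (fun _ => x))} with hX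
  have hunc : ¬ X.Countable := hsat.not_countable φ v hinf
  set F := dclEmpty L' N
  have hF : (F : Set N).Countable := countable_dclEmpty N
  -- Saturation makes X uncountable, while the algebraic closure of a countable set over F is
  -- countable.
  have pick : ∀ P : Set N, P.Countable → ∃ x ∈ X, x ∉ algCl F P := by
    intro P hP
    by_contra! h
    exact hunc ((countable_algCl hF hP).mono h)
  intro z
  rcases eq_or_ne z 0 with rfl | hz
  · obtain ⟨a, ha, b, hb, hab⟩ := hinf.nontrivial
    exact ⟨![a, a, a, b], by intro i; fin_cases i <;> assumption, hab, by simp⟩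
  by_contra hcon
  have hinj : ∀ a ∈ X, ∀ b ∈ X, ∀ c ∈ X, ∀ d ∈ X, a + z * b = c + z * d → b = d := by
    intro a ha b hb c hc d hd he
    by_contra hne
    refine hcon ⟨![c, a, b, d], ?_, hne, ?_⟩
    · intro i; fin_cases i <;> assumption
    · change z * b + a = z * d + c
      linear_combination he
  have hPc : (insert z (Set.range v)).Countable := (Set.countable_range v).insert z
  obtain ⟨x, hx, hxP⟩ := pick _ hPc
  obtain ⟨y, hy, hyP⟩ := pick _ (hPc.insert x)
  set w := x + z * y with hw
  let T1 : ring.Term (((α ⊕ Fin 2) ⊕ Unit) ⊕ Unit) := Term.var (Sum.inl (Sum.inr ()))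
  let T2 : ring.Term (((α ⊕ Fin 2) ⊕ Unit) ⊕ Unit) := Term.var (Sum.inr ())
  let Tz : ring.Term (((α ⊕ Fin 2) ⊕ Unit) ⊕ Unit) := Term.var (Sum.inl (Sum.inl (Sum.inr 0)))
  let Tw : ring.Term (((α ⊕ Fin 2) ⊕ Unit) ⊕ Unit) := Term.var (Sum.inl (Sum.inl (Sum.inr 1)))
  -- χ defines, over v, z and w, the first coordinates of the fibre of (x, y) ↦ x + zy above w.
  -- Injectivity leaves only x.
  let χ : (fieldLang L').Formula ((α ⊕ Fin 2) ⊕ Unit) := Formula.iExs Unit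
    ((φ.relabel (Sum.elim (fun a => Sum.inl (Sum.inl (Sum.inl a)))
        (fun _ => Sum.inl (Sum.inr ())))) ⊓
      (φ.relabel (Sum.elim (fun a => Sum.inl (Sum.inl (Sum.inl a))) (fun _ => Sum.inr ()))) ⊓
      (LHom.sumInl : ring →ᴸ fieldLang L').onFormula (Term.equal (T1 + Tz * T2) Tw))
  have hχ : ∀ x' : N, χ.Realize (Sum.elim (Sum.elim v ![z, w]) (fun _ => x')) ↔
      ∃ y' ∈ X, x' ∈ X ∧ x' + z * y' = w := by
    intro x'
    have h1 : ∀ u : Unit → N, Sum.elim (Sum.elim (Sum.elim v ![z, w]) (fun _ : Unit => x')) u ∘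
        Sum.elim (fun a => Sum.inl (Sum.inl (Sum.inl a))) (fun _ : Unit => Sum.inl (Sum.inr ())) =
        Sum.elim v (fun _ => x') := by
      intro u
      funext j
      cases j <;> rfl
    have h2 : ∀ u : Unit → N, Sum.elim (Sum.elim (Sum.elim v ![z, w]) (fun _ : Unit => x')) u ∘
        Sum.elim (fun a => Sum.inl (Sum.inl (Sum.inl a))) (fun _ : Unit => Sum.inr ()) =
        Sum.elim v (fun _ => u ()) := by
      intro u
      funext j
      cases j <;> rfl
    simp only [χ, T1, T2, Tz, Tw, Formula.realize_iExs, Formula.realize_inf,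
      Formula.realize_relabel, h1, h2, LHom.realize_onFormula, Formula.realize_equal, realize_add,
      realize_mul, Term.realize_var, Sum.elim_inl, Sum.elim_inr, Matrix.cons_val_zero,
      Matrix.cons_val_one, hX, Set.mem_ofPred_eq]
    constructor
    · rintro ⟨u, ⟨h3, h4⟩, h5⟩
      exact ⟨u (), h4, h3, h5⟩
    · rintro ⟨y', h3, h4, h5⟩
      exact ⟨fun _ => y', ⟨h4, h3⟩, h5⟩
  have hsub : {x' : N | χ.Realize (Sum.elim (Sum.elim v ![z, w]) (fun _ => x'))} ⊆ {x} := by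
    intro x' hx'
    obtain ⟨y', hy', hx'X, he⟩ := (hχ x').1 hx'
    have : y' = y := hinj _ hx'X _ hy' _ hx _ hy he
    rw [this, hw] at he
    exact add_right_cancel he
  have hxw := mem_algCl_of_finite hbdd hN χ _ ((Set.finite_singleton x).subset hsub)
    ((hχ x).2 ⟨y, hy, hx, rfl⟩)
  have hrange : Set.range (Sum.elim v ![z, w]) = insert w (insert z (Set.range v)) := by
    rw [Set.Sum.elim_range]
    ext t
    simp
  rw [hrange] at hxw
  have hwx := algCl_exchange F hxw hxP
  refine hyP ?_
  have hy' : y = (w - x) / z := by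
    rw [hw]
    field_simp
    ring
  rw [hy']
  have hxm : x ∈ algCl F (insert x (insert z (Set.range v))) := subset_algCl F _ (by simp)
  have hzm : z ∈ algCl F (insert x (insert z (Set.range v))) := subset_algCl F _ (by simp)
  exact div_mem (H := algClSubfield F _) (sub_mem (mem_algClSubfield.2 hwx) hxm) hzm

/-- Bigness is first-order, so it may be checked in a saturated elementary extension, where the set
remains infinite. -/
theorem big_of_infinite [Countable L'.Symbols] (hbdd : AlgebraicallyBounded L' M) {N : Type}
    [Field N] [CompatibleRing N] [L'.Structure N] (hN : N ⊨ (fieldLang L').completeTheory M)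
    {α : Type} [Countable α] (φ : (fieldLang L').Formula (α ⊕ Unit)) (v : α → N)
    (hinf : {x : N | φ.Realize (Sum.elim v (fun _ => x))}.Infinite) :
    Big {x : N | φ.Realize (Sum.elim v (fun _ => x))} := by
  obtain ⟨N', S, e, hsat⟩ := exists_elementaryEmbedding_realizesCountableTypes (fieldLang L') N
  have hN' : N' ⊨ (fieldLang L').completeTheory M := (e.theory_model_iff _).1 hN
  obtain ⟨_, _, _, rfl⟩ := exists_fieldStructure hN'
  rw [← realize_bigFormula, ← e.map_formula, realize_bigFormula]
  refine big_of_infinite_of_realizesCountableTypes hbdd hN' hsat φ _ ?_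
  refine (hinf.image e.injective.injOn).mono ?_
  rintro _ ⟨x, hx, rfl⟩
  have := (e.map_formula φ (Sum.elim v (fun _ => x))).2 hx
  rw [Sum.comp_elim] at this
  exact this

/-- Every element of the tuple `x` is transcendental over the field generated by `E`, `X` and the
preceding elements. -/
def SeqIndependent {K : Type} [Field K] (E : Subfield K) (X : Set K) {n : ℕ} (x : Fin n → K) :
    Prop :=
  ∀ i, x i ∉ algCl E (X ∪ x '' {j | j < i})

theorem image_castSucc_lt {K : Type} {n : ℕ} (x : Fin (n + 1) → K) (i : Fin n) :
    x '' {j | j < i.castSucc} = Fin.init x '' {j | j < i} := by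
  ext y
  constructor
  · rintro ⟨j, hj, rfl⟩
    have : (j : ℕ) < i := hj
    exact ⟨⟨j, by omega⟩, hj, rfl⟩
  · rintro ⟨j, hj, rfl⟩
    exact ⟨j.castSucc, hj, rfl⟩

theorem image_lt_last {K : Type} {n : ℕ} (x : Fin (n + 1) → K) :
    x '' {j | j < Fin.last n} = Set.range (Fin.init x) := by
  ext y
  constructor
  · rintro ⟨j, hj, rfl⟩
    exact ⟨⟨j, hj⟩, rfl⟩
  · rintro ⟨j, rfl⟩
    exact ⟨j.castSucc, Fin.castSucc_lt_last j, rfl⟩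

theorem SeqIndependent.init {K : Type} [Field K] {E : Subfield K} {X : Set K} {n : ℕ}
    {x : Fin (n + 1) → K} (h : SeqIndependent E X x) : SeqIndependent E X (Fin.init x) := by
  intro i
  rw [← image_castSucc_lt]
  exact h i.castSucc

theorem SeqIndependent.last {K : Type} [Field K] {E : Subfield K} {X : Set K} {n : ℕ}
    {x : Fin (n + 1) → K} (h : SeqIndependent E X x) :
    x (Fin.last n) ∉ algCl E (X ∪ Set.range (Fin.init x)) := by
  rw [← image_lt_last]
  exact h (Fin.last n)

theorem SeqIndependent.snoc {K : Type} [Field K] {E : Subfield K} {X : Set K} {n : ℕ}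
    {x : Fin n → K} (h : SeqIndependent E X x) {y : K} (hy : y ∉ algCl E (X ∪ Set.range x)) :
    SeqIndependent E X (Fin.snoc x y : Fin (n + 1) → K) := by
  intro i
  refine Fin.lastCases ?_ (fun i => ?_) i
  · rw [image_lt_last, Fin.snoc_last, Fin.init_snoc]
    exact hy
  · rw [image_castSucc_lt, Fin.snoc_castSucc, Fin.init_snoc]
    exact h i

/-- Peel off the last coordinate: it is not algebraic over the parameters and the earlier
coordinates, so the fibre containing it is infinite, hence big. Bigness of the fibre is itself a
formula true of the shorter tuple, to which induction applies. -/
theorem large_of_seqIndependent [Countable L'.Symbols] (hbdd : AlgebraicallyBounded L' M)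
    {N : Type} [Field N] [CompatibleRing N] [L'.Structure N]
    (hN : N ⊨ (fieldLang L').completeTheory M) {α : Type} [Countable α] (v : α → N) :
    ∀ (n : ℕ) (φ : (fieldLang L').Formula (α ⊕ Fin n)) (x : Fin n → N),
    φ.Realize (Sum.elim v x) → SeqIndependent (dclEmpty L' N) (Set.range v) x →
      Large n {x : Fin n → N | φ.Realize (Sum.elim v x)}
  | 0, φ, x, hx, _ => by
    change φ.Realize _
    convert hx
  | n + 1, φ, x, hx, hind => by
    have hlast := hind.last
    rw [← Set.Sum.elim_range] at hlast
    let ψ := φ.relabel (Sum.elim (fun g => Sum.inl (Sum.inl g))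
        (Fin.lastCases (motive := fun _ => (α ⊕ Fin n) ⊕ Unit) (Sum.inr ())
          (fun i => Sum.inl (Sum.inr i))))
    have hψ : ∀ (x : Fin n → N) (y : N), ψ.Realize (Sum.elim (Sum.elim v x) (fun _ => y)) ↔
        φ.Realize (Sum.elim v (Fin.snoc x y : Fin (n + 1) → N)) := by
      intro x y
      simp only [ψ, Formula.realize_relabel, elim_snoc_eq]
    have hmem : ψ.Realize (Sum.elim (Sum.elim v (Fin.init x)) (fun _ => x (Fin.last n))) := by
      rw [hψ, Fin.snoc_init_self]
      exact hx
    have hbig := big_of_infinite hbdd hN ψ (Sum.elim v (Fin.init x))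
      (fun hfin => hlast (mem_algCl_of_finite hbdd hN ψ _ hfin hmem))
    have ih := large_of_seqIndependent hbdd hN v n (bigFormula ψ) (Fin.init x)
      ((realize_bigFormula ψ _).2 hbig) hind.init
    simp only [realize_bigFormula, hψ] at ih
    exact ih

/-- A big set is contained in no proper subfield, in particular not in the algebraic closure of X
and the coordinates chosen so far. Definability of Y is not needed. -/
theorem exists_seqIndependent_of_large {K : Type} [Field K] {E : Subfield K} {X : Set K}
    (hrank : ∀ P : Set K, P.Finite → ∃ b, b ∉ algCl E (X ∪ P)) :
    ∀ (n : ℕ) (Y : Set (Fin n → K)), Large n Y → ∃ x ∈ Y, SeqIndependent E X x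
  | 0, _, h => ⟨_, h, fun i => i.elim0⟩
  | n + 1, Y, h => by
    obtain ⟨x, hx, hind⟩ := exists_seqIndependent_of_large hrank n _ h
    obtain ⟨b, hb⟩ := hrank (Set.range x) (Set.finite_range x)
    obtain ⟨y, hy, hy'⟩ := Big.not_subset hx (E := algClSubfield E (X ∪ Set.range x)) hb
    exact ⟨_, hy, hind.snoc hy'⟩

end Large

/-! ### Elementary extensions of infinite rank -/

section InfiniteRank

variable {L' : FirstOrder.Language.{0, 0}} {M : Type} [Field M] [CompatibleRing M] [L'.Structure M]

theorem exists_notMem_algCl_of_hasInfiniteRank (hbdd : AlgebraicallyBounded L' M) {K : Type}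
    [Field K] [CompatibleRing K] [L'.Structure K] (hK : K ⊨ (fieldLang L').completeTheory M)
    (h : HasInfiniteRank L' K) {P : Set K} (hP : P.Finite) : ∃ b, b ∉ algCl (dclEmpty L' K) P := by
  obtain ⟨A, hA, hind⟩ := h
  refine ne_univ_of_infinite_independent hA (fun a ha h => hind a ha ?_) hP
  rw [hbdd K hK]
  change IsAlgebraic _ a at h
  rw [← Set.union_assoc, Set.union_self]
  exact h

theorem names_map_of_realize_iff {A B : Type} [(fieldLang L').Structure A]
    [(fieldLang L').Structure B] (f : A → B)
    (hf : ∀ (n : ℕ) (φ : (fieldLang L').Formula (Fin n)) (x : Fin n → A),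
      φ.Realize (f ∘ x) ↔ φ.Realize x)
    (hAB : B ⊨ (fieldLang L').completeTheory A) {φ : (fieldLang L').Formula (Fin 1)} {a : A}
    (ha : Names φ a) : Names φ (f a) :=
  names_of_realize hAB ha ((hf 1 φ (fun _ => a)).2 ((ha a).2 rfl))

theorem mem_dclEmpty_iff {K : Type} [Field K] [CompatibleRing K] [L'.Structure K] {a : K} :
    a ∈ dclEmpty L' K ↔ ∃ φ : (fieldLang L').Formula (Fin 1), Names φ a := by
  constructor
  · intro ha
    obtain ⟨φ, hφ⟩ := Set.empty_definable_iff.1 ha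
    exact ⟨φ, fun x => (Set.ext_iff.1 hφ (fun _ => x)).symm⟩
  · rintro ⟨φ, hφ⟩
    refine Set.empty_definable_iff.2 ⟨φ, ?_⟩
    ext x
    have h := hφ (x 0)
    have e : (fun _ => x 0) = x := funext fun i => by rw [Subsingleton.elim i 0]
    rw [e] at h
    exact h.symm

/-- Elementary maps between models as field homomorphisms. -/
def fieldHom {A B : Type} [Field A] [CompatibleRing A] [L'.Structure A] [Field B]
    [CompatibleRing B] [L'.Structure B] (f : A ↪[fieldLang L'] B) : A →+* B where
  toFun := f
  map_one' := by
    have := f.map_fun (LHom.sumInl.onFunction oneFunc : (fieldLang L').Functions 0) ![]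
    change f (Structure.funMap oneFunc ![]) = Structure.funMap oneFunc _ at this
    simpa using this
  map_zero' := by
    have := f.map_fun (LHom.sumInl.onFunction zeroFunc : (fieldLang L').Functions 0) ![]
    change f (Structure.funMap zeroFunc ![]) = Structure.funMap zeroFunc _ at this
    simpa using this
  map_add' := fun x y => by
    have := f.map_fun (LHom.sumInl.onFunction addFunc : (fieldLang L').Functions 2) ![x, y]
    change f (Structure.funMap addFunc ![x, y]) = Structure.funMap addFunc _ at this
    simpa using this
  map_mul' := fun x y => by
    have := f.map_fun (LHom.sumInl.onFunction mulFunc : (fieldLang L').Functions 2) ![x, y]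
    change f (Structure.funMap mulFunc ![x, y]) = Structure.funMap mulFunc _ at this
    simpa using this

@[simp]
theorem fieldHom_apply {A B : Type} [Field A] [CompatibleRing A] [L'.Structure A] [Field B]
    [CompatibleRing B] [L'.Structure B] (f : A ↪[fieldLang L'] B) (x : A) : fieldHom f x = f x :=
  rfl

theorem map_mem_algCl {A B : Type} [Field A] [Field B] (f : A →+* B) {E : Subfield A} {X : Set A}
    {E' : Subfield B} {X' : Set B} (hE : ∀ e ∈ E, f e ∈ E') (hX : ∀ x ∈ X, f x ∈ X') {a : A}
    (ha : a ∈ algCl E X) : f a ∈ algCl E' X' := by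
  have hle : Subfield.closure ((E : Set A) ∪ X) ≤
      (Subfield.closure ((E' : Set B) ∪ X')).comap f := by
    rw [Subfield.closure_le]
    rintro x (hx | hx)
    · exact Subfield.subset_closure (Or.inl (hE x hx))
    · exact Subfield.subset_closure (Or.inr (hX x hx))
  let g : Subfield.closure ((E : Set A) ∪ X) →+* Subfield.closure ((E' : Set B) ∪ X') :=
    { toFun := fun x => ⟨f x, hle x.2⟩
      map_one' := Subtype.ext (map_one f)
      map_mul' := fun _ _ => Subtype.ext (map_mul f _ _)
      map_zero' := Subtype.ext (map_zero f)
      map_add' := fun _ _ => Subtype.ext (map_add f _ _) }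
  exact IsAlgebraic.ringHom_of_comp_eq g f ha g.injective (RingHom.ext fun _ => rfl)

/-- An elementary extension of size continuum has infinite rank because F is countable. A countable
elementary submodel keeping A and countably many independent elements still has infinite rank, since
algebraic dependence would persist upwards. -/
theorem exists_countable_extension_of_infinite_rank [Countable L'.Symbols] [CharZero M]
    (hbdd : AlgebraicallyBounded L' M) (A : Type) [(fieldLang L').Structure A] [Countable A]
    (hA : A ⊨ (fieldLang L').completeTheory M) :
    ∃ (K : Type) (_ : Field K) (_ : CompatibleRing K) (_ : L'.Structure K)
      (_ : A ↪ₑ[fieldLang L'] K),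
      K ⊨ (fieldLang L').completeTheory M ∧ Countable K ∧ HasInfiniteRank L' K := by
  have hAinf : Infinite A := by
    obtain ⟨_, _, _, rfl⟩ := exists_fieldStructure hA
    exact infinite_of_model hA
  obtain ⟨N, ⟨e⟩, hcard⟩ := exists_elementaryEmbedding_card_eq_of_ge.{0, 0, 0, 0} (fieldLang L') A
    Cardinal.continuum
    (by simpa only [Cardinal.lift_id] using
      (card_le_aleph0 (fieldLang L')).trans Cardinal.aleph0_le_continuum)
    (by simpa only [Cardinal.lift_id] using Cardinal.mk_le_aleph0.trans Cardinal.aleph0_le_continuum)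
  obtain ⟨N, S⟩ := N
  change Cardinal.mk N = _ at hcard
  change A ↪ₑ[fieldLang L'] N at e
  have hN : N ⊨ (fieldLang L').completeTheory M := (e.theory_model_iff _).1 hA
  obtain ⟨_, _, _, rfl⟩ := exists_fieldStructure hN
  have hNinf : Infinite N := infinite_of_model hN
  have hunc : ¬ Countable N := by
    rw [← Cardinal.mk_le_aleph0_iff, hcard, not_le]
    exact Cardinal.aleph0_lt_continuum
  obtain ⟨B, hB, hind⟩ := exists_infinite_independent (countable_dclEmpty (L' := L') N) hunc
  obtain ⟨B₀, hB₀, hB₀inf, hB₀c⟩ : ∃ B₀ ⊆ B, B₀.Infinite ∧ B₀.Countable := by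
    have := hB.to_subtype
    refine ⟨Set.range (fun n => (Infinite.natEmbedding B n : N)), ?_,
      Set.infinite_range_of_injective
        (Subtype.val_injective.comp (Infinite.natEmbedding B).injective), Set.countable_range _⟩
    rintro _ ⟨n, rfl⟩
    exact (Infinite.natEmbedding B n).2
  obtain ⟨K, hK, hKc⟩ := exists_countable_elementarySubstructure (fieldLang L') N
    (hB₀c.union (Set.countable_range e))
  have hKT : K ⊨ (fieldLang L').completeTheory M := (K.theory_model_iff _).2 hN
  let e' : A ↪ₑ[fieldLang L'] K :=
    { toFun := fun a => ⟨e a, hK (Or.inr ⟨a, rfl⟩)⟩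
      map_formula' := fun n φ x => by
        rw [← K.subtype.map_formula, ← e.map_formula φ x]
        rfl }
  let i : K ↪ₑ[fieldLang L'] N := K.subtype
  have hi : Function.Injective i := i.injective
  have hiB : B₀ ⊆ Set.range i := fun b hb => ⟨⟨b, hK (Or.inl hb)⟩, rfl⟩
  clear_value i e'
  -- The submodel is now an abstract structure with an elementary embedding into N, so it can be
  -- rewritten as a field expansion.
  generalize hS : ElementarySubstructure.inducedStructure K = SK at *
  clear hS
  revert SK
  generalize (↥K) = K' at *
  intro SK hKT e' i hi hiB
  obtain ⟨_, _, _, rfl⟩ := exists_fieldStructure hKT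
  refine ⟨K', _, _, _, e', hKT, hKc, i ⁻¹' B₀, ?_, ?_⟩
  · exact hB₀inf.preimage hiB
  · intro a ha hacl
    rw [hbdd K' hKT] at hacl
    rw [← Set.union_assoc, Set.union_self] at hacl
    refine hind (i a) (hB₀ ha) ?_
    refine map_mem_algCl (fieldHom i.toEmbedding) (fun c hc => ?_) (fun c hc => ?_)
      (show a ∈ algCl _ _ from hacl)
    · obtain ⟨φ, hφ⟩ := mem_dclEmpty_iff.1 hc
      have hNK : N ⊨ (fieldLang L').completeTheory K' :=
        (i.theory_model_iff _).1 inferInstance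
      exact mem_dclEmpty_iff.2 ⟨φ, names_map_of_realize_iff i
        (fun n φ x => i.map_formula φ x) hNK hφ⟩
    · exact ⟨hB₀ hc.1, fun he => hc.2 (hi he)⟩

theorem exists_countable_model_of_infinite_rank [Countable L'.Symbols] [CharZero M]
    (hbdd : AlgebraicallyBounded L' M) :
    ∃ (K : Type) (_ : Field K) (_ : CompatibleRing K) (_ : L'.Structure K),
      K ⊨ (fieldLang L').completeTheory M ∧ Countable K ∧ HasInfiniteRank L' K := by
  have hM : M ⊨ (fieldLang L').completeTheory M := inferInstance
  have := infinite_of_model hM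
  obtain ⟨S, -, hS⟩ := exists_countable_elementarySubstructure (fieldLang L') M
    (Set.countable_empty)
  obtain ⟨K, h1, h2, h3, -, h⟩ := exists_countable_extension_of_infinite_rank hbdd S
    ((S.theory_model_iff _).2 hM)
  exact ⟨K, h1, h2, h3, h⟩

end InfiniteRank

/-! ### The theory of generic derivations -/

section GenericTheory

variable {L' : FirstOrder.Language.{0, 0}}

/-- The formula `∃ y, θ(p, x, y)`. -/
noncomputable def projFormula {α : Type} {n : ℕ}
    (θ : (fieldLang L').Formula (α ⊕ (Fin n ⊕ Fin n))) : (fieldLang L').Formula (α ⊕ Fin n) :=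
  Formula.iExs (Fin n) (θ.relabel (Sum.elim (fun i => Sum.inl (Sum.inl i))
    (Sum.elim (fun j => Sum.inl (Sum.inr j)) Sum.inr)))

/-- The formula `θ(p, x, δ x)`. -/
noncomputable def deltaFormula {α : Type} {n : ℕ}
    (θ : (fieldLang L').Formula (α ⊕ (Fin n ⊕ Fin n))) : (diffLang L').Formula (α ⊕ Fin n) :=
  BoundedFormula.subst ((LHom.sumInl : fieldLang L' →ᴸ diffLang L').onFormula θ)
    (Sum.elim (fun i => Term.var (Sum.inl i))
      (Sum.elim (fun j => Term.var (Sum.inr j)) (fun j => deltaTerm (Term.var (Sum.inr j)))))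

/-- The sentence saying, for all parameters `p`, that if the projection of the set defined by
`θ(p, x, y)` to the `x`-coordinates is large, then `θ(p, x, δ x)` has a solution. -/
noncomputable def wideAxiom {m n : ℕ} (θ : (fieldLang L').Formula (Fin m ⊕ (Fin n ⊕ Fin n))) :
    (diffLang L').Sentence :=
  Formula.iAlls (Fin m) (Formula.relabel (Sum.inr : Fin m → Empty ⊕ Fin m)
    (((LHom.sumInl : fieldLang L' →ᴸ diffLang L').onFormula (largeFormula n (projFormula θ))).imp
      (Formula.iExs (Fin n) (deltaFormula θ))))

section Realize

variable {N : Type} [Field N] [CompatibleRing N] [L'.Structure N]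

theorem realize_projFormula {α : Type} {n : ℕ}
    (θ : (fieldLang L').Formula (α ⊕ (Fin n ⊕ Fin n))) (p : α → N) (x : Fin n → N) :
    (projFormula θ).Realize (Sum.elim p x) ↔
      ∃ y : Fin n → N, θ.Realize (Sum.elim p (Sum.elim x y)) := by
  simp only [projFormula, Formula.realize_iExs, Formula.realize_relabel]
  refine exists_congr fun y => ?_
  rw [iff_iff_eq]
  congr 1
  funext j
  rcases j with j | j | j <;> rfl

theorem realize_deltaFormula (δ : N → N) {α : Type} {n : ℕ}
    (θ : (fieldLang L').Formula (α ⊕ (Fin n ⊕ Fin n))) (p : α → N) (x : Fin n → N) :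
    (let _ := deltaStructure δ; (deltaFormula θ).Realize (Sum.elim p x)) ↔
      θ.Realize (Sum.elim p (Sum.elim x (δ ∘ x))) := by
  let _ := deltaStructure δ
  simp only [deltaFormula, Formula.Realize, BoundedFormula.realize_subst]
  refine Iff.trans (LHom.realize_onFormula (LHom.sumInl : fieldLang L' →ᴸ diffLang L') θ) ?_
  rw [iff_iff_eq]
  congr 1
  funext j
  rcases j with j | j | j
  · rfl
  · rfl
  · exact realize_deltaTerm δ _ _

theorem realize_wideAxiom (δ : N → N) {m n : ℕ}
    (θ : (fieldLang L').Formula (Fin m ⊕ (Fin n ⊕ Fin n))) :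
    (let _ := deltaStructure δ; N ⊨ wideAxiom θ) ↔
      ∀ p : Fin m → N, Large n {x | ∃ y : Fin n → N, θ.Realize (Sum.elim p (Sum.elim x y))} →
        ∃ x, θ.Realize (Sum.elim p (Sum.elim x (δ ∘ x))) := by
  let _ := deltaStructure δ
  simp only [wideAxiom, Sentence.Realize, Formula.realize_iAlls, Formula.realize_relabel,
    Formula.realize_imp, LHom.realize_onFormula, realize_largeFormula, Formula.realize_iExs,
    Sum.elim_comp_inr, realize_projFormula]
  refine forall_congr' fun p => imp_congr Iff.rfl (exists_congr fun x => ?_)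
  exact realize_deltaFormula δ θ p x

end Realize

variable {M : Type} [Field M] [CompatibleRing M] [L'.Structure M]

/-- The theory of generic derivations extending `η`. -/
def genericTheory (η : Derivation ℤ (dclEmpty L' M) (dclEmpty L' M)) : (diffLang L').Theory :=
  diffTheory L' η ∪ {σ | ∃ (m n : ℕ) (θ : (fieldLang L').Formula (Fin m ⊕ (Fin n ⊕ Fin n))),
    σ = wideAxiom θ}

theorem modelsWith_genericTheory_iff {η : Derivation ℤ (dclEmpty L' M) (dclEmpty L' M)} {N : Type}
    [Field N] [CompatibleRing N] [L'.Structure N] (δ : N → N) :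
    ModelsWith δ (genericTheory η) ↔ ModelsWith δ (diffTheory L' η) ∧
      ∀ (m n : ℕ) (θ : (fieldLang L').Formula (Fin m ⊕ (Fin n ⊕ Fin n))) (p : Fin m → N),
        Large n {x | ∃ y : Fin n → N, θ.Realize (Sum.elim p (Sum.elim x y))} →
        ∃ x, θ.Realize (Sum.elim p (Sum.elim x (δ ∘ x))) := by
  let _ := deltaStructure δ
  simp only [ModelsWith, genericTheory, Theory.model_union_iff]
  refine and_congr Iff.rfl ?_
  constructor
  · intro h m n θ
    exact (realize_wideAxiom δ θ).1 (h.realize_of_mem _ ⟨m, n, θ, rfl⟩)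
  · intro h
    refine ⟨?_⟩
    rintro _ ⟨m, n, θ, rfl⟩
    exact (realize_wideAxiom δ θ).2 (h m n θ)

end GenericTheory

/-! ### The space of derivations -/

section Topology

/-- Values are corrected one coordinate at a time, by adding a multiple of a derivation that kills
E, X and the earlier coordinates and takes the value 1 at the current one. -/
theorem exists_derivation_seq {K : Type} [Field K] [CharZero K] {E : Subfield K} {X : Set K}
    (D₀ : Derivation ℤ K K) : ∀ (n : ℕ) (x y : Fin n → K), SeqIndependent E X x →
    ∃ D : Derivation ℤ K K, (∀ e ∈ E, D e = D₀ e) ∧ (∀ e ∈ X, D e = D₀ e) ∧ ∀ i, D (x i) = y i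
  | 0, _, _, _ => ⟨D₀, fun _ _ => rfl, fun _ _ => rfl, fun i => i.elim0⟩
  | n + 1, x, y, h => by
    obtain ⟨D, h1, h2, h3⟩ := exists_derivation_seq D₀ n (Fin.init x) (Fin.init y) h.init
    obtain ⟨Δ, hΔ, hΔ1⟩ := exists_derivation_of_transcendental _ h.last
    have hz : ∀ e ∈ (E : Set K) ∪ (X ∪ Set.range (Fin.init x)), Δ e = 0 := fun e he =>
      hΔ e (Subfield.subset_closure he)
    refine ⟨D + (y (Fin.last n) - D (x (Fin.last n))) • Δ, fun e he => ?_, fun e he => ?_,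
      fun i => ?_⟩
    · rw [Derivation.add_apply, Derivation.smul_apply, hz e (Or.inl he), smul_zero, add_zero,
        h1 e he]
    · rw [Derivation.add_apply, Derivation.smul_apply, hz e (Or.inr (Or.inl he)), smul_zero,
        add_zero, h2 e he]
    · refine Fin.lastCases ?_ (fun i => ?_) i
      · rw [Derivation.add_apply, Derivation.smul_apply, hΔ1, smul_eq_mul, mul_one]
        ring
      · rw [Derivation.add_apply, Derivation.smul_apply,
          hz (x i.castSucc) (Or.inr (Or.inr ⟨i, rfl⟩)), smul_zero, add_zero]
        exact h3 i

variable {L' : FirstOrder.Language.{0, 0}} {M : Type} [Field M] [CompatibleRing M] [L'.Structure M]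
  {K : Type} [Field K] [CompatibleRing K] [L'.Structure K]
  {η : Derivation ℤ (dclEmpty L' M) (dclEmpty L' M)}

theorem derExt_of_eq_on_dclEmpty (D : DerExt L' K η) {D' : Derivation ℤ K K}
    (h : ∀ e ∈ dclEmpty L' K, D' e = D.1 e) :
    ∀ (a : dclEmpty L' M) (φ ψ : (fieldLang L').Formula (Fin 1)) (x y : K),
    Names φ (a : M) → Names ψ (η a : M) → Names φ x → Names ψ y → D' x = y := by
  intro a φ ψ x y h1 h2 h3 h4
  rw [h x (mem_dclEmpty_iff.2 ⟨φ, h3⟩)]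
  exact D.2 a φ ψ x y h1 h2 h3 h4

/-- The heart of density: choose x in the large projection independent over S, and a partner y.
Independence leaves the values at x free, so they can be set to y without disturbing S or F. -/
theorem exists_derExt_eq_on_finite [CharZero M] (hbdd : AlgebraicallyBounded L' M)
    (hK : K ⊨ (fieldLang L').completeTheory M) (hrank : HasInfiniteRank L' K)
    (D₀ : DerExt L' K η) {S : Set K} (hS : S.Finite) {n : ℕ} (R : (Fin n → K) → (Fin n → K) → Prop)
    (hR : Large n {x | ∃ y, R x y}) :
    ∃ D : DerExt L' K η, (∀ s ∈ S, D.1 s = D₀.1 s) ∧ ∃ x, R x (D.1 ∘ x) := by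
  have := charZero_of_model hK
  obtain ⟨x, ⟨y, hxy⟩, hind⟩ := exists_seqIndependent_of_large (E := dclEmpty L' K) (X := S)
    (fun P hP => exists_notMem_algCl_of_hasInfiniteRank hbdd hK hrank (hS.union hP)) n _ hR
  obtain ⟨D, h1, h2, h3⟩ := exists_derivation_seq D₀.1 n x y hind
  refine ⟨⟨D, derExt_of_eq_on_dclEmpty D₀ h1⟩, h2, x, ?_⟩
  convert hxy using 1
  funext i
  exact h3 i

theorem isClopen_derExt (n : ℕ) (x : Fin n → K) (P : (Fin n → K) → Prop) :
    IsClopen {D : DerExt L' K η | P (fun i => D.1 (x i))} := by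
  let _ : TopologicalSpace K := ⊥
  have : DiscreteTopology K := ⟨rfl⟩
  have hc : Continuous (fun D : DerExt L' K η => (D.1 : K → K)) := continuous_induced_dom
  have h2 : Continuous (fun D : DerExt L' K η => fun i => D.1 (x i)) :=
    continuous_pi fun i => (continuous_apply (x i)).comp hc
  exact (isClopen_discrete {u | P u}).preimage h2

theorem exists_finite_of_isOpen {U : Set (DerExt L' K η)} (hU : IsOpen U) {D : DerExt L' K η}
    (hD : D ∈ U) : ∃ S : Set K, S.Finite ∧
      ∀ D' : DerExt L' K η, (∀ s ∈ S, D'.1 s = D.1 s) → D' ∈ U := by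
  let _ : TopologicalSpace K := ⊥
  obtain ⟨V, hV, rfl⟩ := isOpen_induced_iff.1 hU
  obtain ⟨I, u, h1, h2⟩ := isOpen_pi_iff.1 hV _ hD
  refine ⟨I, I.finite_toSet, fun D' h => h2 fun i hi => ?_⟩
  change D'.1 i ∈ u i
  rw [h i hi]
  exact (h1 i hi).2

theorem isOpen_eq_on_finite {S : Set K} (hS : S.Finite) (D : DerExt L' K η) :
    IsOpen {D' : DerExt L' K η | ∀ s ∈ S, D'.1 s = D.1 s} := by
  have : {D' : DerExt L' K η | ∀ s ∈ S, D'.1 s = D.1 s} =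
      ⋂ s ∈ S, {D' : DerExt L' K η | D'.1 s = D.1 s} := by
    ext
    simp
  rw [this]
  exact hS.isOpen_biInter fun s _ =>
    (isClopen_derExt 1 (fun _ => s) (fun u => u 0 = D.1 s)).isOpen

/-- For countable discrete K the product K^K is Polish. Each defining condition involves finitely
many values of the function, so the derivations form a closed subset. -/
theorem polishSpace_derExt [Countable K] : PolishSpace (DerExt L' K η) := by
  let _ : TopologicalSpace K := ⊥
  have : DiscreteTopology K := ⟨rfl⟩
  have : PolishSpace K := inferInstance
  refine Topology.IsClosedEmbedding.polishSpace (β := K → K)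
    (f := fun D : DerExt L' K η => (D.1 : K → K)) ?_
  refine ⟨⟨⟨rfl⟩, fun D D' h => Subtype.ext (Derivation.ext (congrFun h))⟩, ?_⟩
  have hcl : ∀ (n : ℕ) (x : Fin n → K) (P : (Fin n → K) → Prop),
      IsClosed {f : K → K | P (fun i => f (x i))} := by
    intro n x P
    have h2 : Continuous (fun f : K → K => fun i => f (x i)) :=
      continuous_pi fun i => continuous_apply (x i)
    exact (isClosed_discrete {u | P u}).preimage h2
  have hrange : Set.range (fun D : DerExt L' K η => (D.1 : K → K)) =
      (⋂ (x : K) (y : K), {f : K → K | f (x + y) = f x + f y}) ∩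
      (⋂ (x : K) (y : K), {f : K → K | f (x * y) = x * f y + y * f x}) ∩
      ⋂ (x : K), {f : K → K | ∀ (a : dclEmpty L' M) (φ ψ : (fieldLang L').Formula (Fin 1)) (y : K),
        Names φ (a : M) → Names ψ (η a : M) → Names φ x → Names ψ y → f x = y} := by
    ext f
    simp only [Set.mem_range, Set.mem_inter_iff, Set.mem_iInter, Set.mem_ofPred_eq]
    constructor
    · rintro ⟨D, rfl⟩
      exact ⟨⟨fun x y => map_add D.1 x y, fun x y => by simp⟩,
        fun x a φ ψ y => D.2 a φ ψ x y⟩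
    · rintro ⟨⟨h1, h2⟩, h3⟩
      exact ⟨⟨Derivation.mk' (AddMonoidHom.mk' f h1).toIntLinearMap (fun x y => by
        simpa using h2 x y), fun a φ ψ x y => h3 x a φ ψ y⟩, rfl⟩
  rw [hrange]
  refine ((isClosed_iInter fun x => isClosed_iInter fun y => ?_).inter
    (isClosed_iInter fun x => isClosed_iInter fun y => ?_)).inter (isClosed_iInter fun x => ?_)
  · exact hcl 3 ![x + y, x, y] (fun u => u 0 = u 1 + u 2)
  · exact hcl 3 ![x * y, x, y] (fun u => u 0 = x * u 2 + y * u 1)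
  · exact hcl 1 ![x] (fun u => ∀ (a : dclEmpty L' M) (φ ψ : (fieldLang L').Formula (Fin 1)) (y : K),
        Names φ (a : M) → Names ψ (η a : M) → Names φ x → Names ψ y → u 0 = y)

/-- The derivations satisfying the axiom attached to `θ` for the parameters `p`. -/
def wideSet (η : Derivation ℤ (dclEmpty L' M) (dclEmpty L' M)) {m n : ℕ}
    (θ : (fieldLang L').Formula (Fin m ⊕ (Fin n ⊕ Fin n))) (p : Fin m → K) :
    Set (DerExt L' K η) :=
  {D | Large n {x | ∃ y : Fin n → K, θ.Realize (Sum.elim p (Sum.elim x y))} →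
    ∃ x, θ.Realize (Sum.elim p (Sum.elim x (D.1 ∘ x)))}

/-- Largeness does not involve the derivation. If it fails the condition is vacuous; otherwise the
set is a union over x of clopen sets. -/
theorem isOpen_wideSet {m n : ℕ} (θ : (fieldLang L').Formula (Fin m ⊕ (Fin n ⊕ Fin n)))
    (p : Fin m → K) : IsOpen (wideSet η θ p) := by
  by_cases h : Large n {x | ∃ y : Fin n → K, θ.Realize (Sum.elim p (Sum.elim x y))}
  · have : wideSet η θ p = ⋃ x : Fin n → K,
        {D : DerExt L' K η | θ.Realize (Sum.elim p (Sum.elim x (fun i => D.1 (x i))))} := by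
      ext D
      simp only [wideSet, h, Set.mem_ofPred_eq, Set.mem_iUnion, true_imp_iff]
      rfl
    rw [this]
    exact isOpen_iUnion fun x => (isClopen_derExt n x
      (fun u => θ.Realize (Sum.elim p (Sum.elim x u)))).isOpen
  · have : wideSet η θ p = (Set.univ : Set (DerExt L' K η)) := by
      ext D
      simp [wideSet, h]
    rw [this]
    exact isOpen_univ

theorem dense_wideSet [CharZero M] (hbdd : AlgebraicallyBounded L' M)
    (hK : K ⊨ (fieldLang L').completeTheory M) (hrank : HasInfiniteRank L' K) {m n : ℕ}
    (θ : (fieldLang L').Formula (Fin m ⊕ (Fin n ⊕ Fin n))) (p : Fin m → K) :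
    Dense (wideSet η θ p) := by
  rw [dense_iff_inter_open]
  rintro U hU ⟨D₀, hD₀⟩
  obtain ⟨S, hS, hSU⟩ := exists_finite_of_isOpen hU hD₀
  by_cases h : Large n {x | ∃ y : Fin n → K, θ.Realize (Sum.elim p (Sum.elim x y))}
  · obtain ⟨D, hD, hx⟩ := exists_derExt_eq_on_finite hbdd hK hrank D₀ hS
      (fun x y => θ.Realize (Sum.elim p (Sum.elim x y))) h
    exact ⟨D, hSU D hD, fun _ => hx⟩
  · exact ⟨D₀, hD₀, fun h' => absurd h' h⟩

theorem setOf_modelsWith_genericTheory (hK : K ⊨ (fieldLang L').completeTheory M) :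
    {D : DerExt L' K η | ModelsWith (D.1 : K → K) (genericTheory η)} =
      ⋂ q : (m : ℕ) × (n : ℕ) ×
        ((fieldLang L').Formula (Fin m ⊕ (Fin n ⊕ Fin n)) × (Fin m → K)),
        wideSet η q.2.2.1 q.2.2.2 := by
  ext D
  simp only [Set.mem_ofPred_eq, modelsWith_genericTheory_iff, modelsWith_diffTheory_iff,
    Set.mem_iInter]
  constructor
  · rintro ⟨-, h⟩ ⟨m, n, θ, p⟩
    exact h m n θ p
  · intro h
    exact ⟨⟨hK, D, rfl⟩, fun m n θ p => h ⟨m, n, θ, p⟩⟩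

theorem isGδ_and_dense_genericTheory [Countable L'.Symbols] [CharZero M]
    (hbdd : AlgebraicallyBounded L' M) [Countable K]
    (hK : K ⊨ (fieldLang L').completeTheory M) (hrank : HasInfiniteRank L' K) :
    IsGδ {D : DerExt L' K η | ModelsWith (D.1 : K → K) (genericTheory η)} ∧
      Dense {D : DerExt L' K η | ModelsWith (D.1 : K → K) (genericTheory η)} := by
  have hc : ∀ m n, Countable ((fieldLang L').Formula (Fin m ⊕ (Fin n ⊕ Fin n))) := fun m n =>
    countable_formula _ _
  have : PolishSpace (DerExt L' K η) := polishSpace_derExt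
  have : BaireSpace (DerExt L' K η) := by
    let _ := TopologicalSpace.upgradeIsCompletelyMetrizable (DerExt L' K η)
    infer_instance
  rw [setOf_modelsWith_genericTheory hK]
  exact ⟨IsGδ.iInter_of_isOpen fun q => isOpen_wideSet _ _,
    dense_iInter_of_isOpen (fun q => isOpen_wideSet _ _)
      (fun q => dense_wideSet hbdd hK hrank _ _)⟩

end Topology

/-! ### Embedding differential models into generic ones -/

section Embedding

theorem exists_countable_elementaryEmbedding (L : FirstOrder.Language.{0, 0}) [Countable L.Symbols]
    (N : Type) [L.Structure N] [Infinite N] {s : Set N} (hs : s.Countable) :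
    ∃ (R : Type) (_ : L.Structure R) (i : R ↪ₑ[L] N), Countable R ∧ s ⊆ Set.range i := by
  obtain ⟨S, h1, h2⟩ := exists_countable_elementarySubstructure L N hs
  exact ⟨S, inferInstance, S.subtype, h2, fun x hx => ⟨⟨x, h1 hx⟩, rfl⟩⟩

variable {L' : FirstOrder.Language.{0, 0}} {M : Type} [Field M] [CompatibleRing M] [L'.Structure M]
  {η : Derivation ℤ (dclEmpty L' M) (dclEmpty L' M)}

/-- Decomposition of a model of `T^δ` into a field expansion and a derivation. -/
theorem exists_decomposition {A : Type} [S : (diffLang L').Structure A]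
    (hA : A ⊨ diffTheory L' η) :
    ∃ (_ : Field A) (c : CompatibleRing A) (l : L'.Structure A) (D : DerExt L' A η),
      A ⊨ (fieldLang L').completeTheory M ∧
      S = @sumStructure (fieldLang L') deltaLang A (@sumStructure ring L' A c.toStructure l)
        (deltaStructure (D.1 : A → A)) := by
  obtain ⟨S₀, δ, rfl⟩ := exists_diffStructure S
  let _ := deltaStructure δ
  have hT : A ⊨ (fieldLang L').completeTheory M := by
    have := (Theory.model_union_iff.1 (Theory.model_union_iff.1 hA).1).1
    exact (LHom.onTheory_model (LHom.sumInl : fieldLang L' →ᴸ diffLang L') _).1 this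
  obtain ⟨_, _, _, rfl⟩ := exists_fieldStructure hT
  obtain ⟨hT, D, rfl⟩ := (modelsWith_diffTheory_iff δ).1 hA
  exact ⟨_, _, _, D, hT, rfl⟩

theorem realize_fieldFormula_of_elementary {A B : Type} [(fieldLang L').Structure A]
    [(fieldLang L').Structure B] (δA : A → A) (δB : B → B)
    (i : let _ := deltaStructure δA; let _ := deltaStructure δB; A ↪ₑ[diffLang L'] B)
    {α : Type} (φ : (fieldLang L').Formula α) (x : α → A) :
    φ.Realize (i ∘ x) ↔ φ.Realize x := by
  let _ := deltaStructure δA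
  let _ := deltaStructure δB
  have := ElementaryEmbedding.map_formula i ((LHom.sumInl : fieldLang L' →ᴸ diffLang L').onFormula φ) x
  rwa [LHom.realize_onFormula, LHom.realize_onFormula] at this

theorem map_delta_of_embedding {A B : Type} [(fieldLang L').Structure A]
    [(fieldLang L').Structure B] (δA : A → A) (δB : B → B)
    (i : let _ := deltaStructure δA; let _ := deltaStructure δB; A ↪[diffLang L'] B) (a : A) :
    i (δA a) = δB (i a) := by
  let _ := deltaStructure δA
  let _ := deltaStructure δB
  exact Embedding.map_fun i
    (LHom.sumInr.onFunction deltaSymbol : (diffLang L').Functions 1) (fun _ => a)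

/-- The reduct of an embedding of differential structures. -/
def reductEmbedding {A B : Type} [(fieldLang L').Structure A]
    [(fieldLang L').Structure B] (δA : A → A) (δB : B → B)
    (i : let _ := deltaStructure δA; let _ := deltaStructure δB; A ↪[diffLang L'] B) :
    A ↪[fieldLang L'] B where
  toFun := i
  inj' := let _ := deltaStructure δA; let _ := deltaStructure δB; i.injective
  map_fun' := fun f x =>
    let _ := deltaStructure δA
    let _ := deltaStructure δB
    Embedding.map_fun i (LHom.sumInl.onFunction f : (diffLang L').Functions _) x
  map_rel' := fun f x =>
    let _ := deltaStructure δA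
    let _ := deltaStructure δB
    Embedding.map_rel i (LHom.sumInl.onRelation f : (diffLang L').Relations _) x

/-- An embedding of the reducts commuting with the derivations. -/
def diffEmbedding {A B : Type} [(fieldLang L').Structure A]
    [(fieldLang L').Structure B] (δA : A → A) (δB : B → B) (i : A ↪[fieldLang L'] B)
    (hi : ∀ a, i (δA a) = δB (i a)) :
    let _ := deltaStructure δA; let _ := deltaStructure δB; A ↪[diffLang L'] B :=
  let _ := deltaStructure δA
  let _ := deltaStructure δB
  { toFun := i
    inj' := i.injective
    map_fun' := fun {n} f x => by
      rcases f with f | f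
      · exact i.map_fun f x
      · cases f
        exact hi (x 0)
    map_rel' := fun {n} r x => by
      rcases r with r | r
      · exact i.map_rel r x
      · exact Empty.elim r }

/-- Elements named in K by a formula naming an element of M are images of elements of A named by the
same formula. -/
theorem derExt_of_embedding {A K : Type} [Field A] [CompatibleRing A] [L'.Structure A]
    [Field K] [CompatibleRing K] [L'.Structure K] (hA : A ⊨ (fieldLang L').completeTheory M)
    (e : A ↪ₑ[fieldLang L'] K) (D : DerExt L' A η) {D' : Derivation ℤ K K}
    (h : ∀ a, D' (e a) = e (D.1 a)) :
    ∀ (a : dclEmpty L' M) (φ ψ : (fieldLang L').Formula (Fin 1)) (x y : K),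
    Names φ (a : M) → Names ψ (η a : M) → Names φ x → Names ψ y → D' x = y := by
  intro a φ ψ x y h1 h2 h3 h4
  have hKA : K ⊨ (fieldLang L').completeTheory A := (e.theory_model_iff _).1 inferInstance
  have key : ∀ (χ : (fieldLang L').Formula (Fin 1)) (b : M) (z : K), Names χ b → Names χ z →
      ∃ z₀, Names χ z₀ ∧ e z₀ = z := by
    intro χ b z hb hz
    obtain ⟨z₀, hz₀⟩ := (realize_existsUnique_iff hA χ).2 ⟨b, hb⟩
    refine ⟨z₀, hz₀, (hz _).1 ?_⟩
    exact (e.map_formula χ (fun _ => z₀)).2 ((hz₀ z₀).2 rfl)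
  obtain ⟨x₀, hx₀, rfl⟩ := key φ _ x h1 h3
  obtain ⟨y₀, hy₀, rfl⟩ := key ψ _ y h2 h4
  rw [h, D.2 a φ ψ x₀ y₀ h1 h2 hx₀ hy₀]

/-- Density is available only for countable models of infinite rank. So restrict to a countable
elementary submodel containing s, enlarge it to infinite rank, extend the derivation, and perturb it
to a generic one away from the image of s. -/
theorem exists_finite_approximation [Countable L'.Symbols] [CharZero M]
    (hbdd : AlgebraicallyBounded L' M) {A : Type} [Field A] [CompatibleRing A] [L'.Structure A]
    (hA : A ⊨ (fieldLang L').completeTheory M) (D : DerExt L' A η) (s : Finset A) :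
    ∃ (K : Type) (_ : (fieldLang L').Structure K) (δ : K → K) (g : A → K),
      Nonempty K ∧ ModelsWith δ (genericTheory η) ∧
      (∀ (n : ℕ) (φ : (fieldLang L').Formula (Fin n)) (x : Fin n → A), (∀ i, x i ∈ s) →
        (φ.Realize (g ∘ x) ↔ φ.Realize x)) ∧
      ∀ a ∈ s, D.1 a ∈ s → g (D.1 a) = δ (g a) := by
  classical
  have hmod : ModelsWith (D.1 : A → A) (diffTheory L' η) :=
    (modelsWith_diffTheory_iff _).2 ⟨hA, D, rfl⟩
  let _ := deltaStructure (D.1 : A → A)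
  have : Infinite A := infinite_of_model hA
  obtain ⟨R, SR, i, hR, hs⟩ := exists_countable_elementaryEmbedding (diffLang L') A
    s.finite_toSet.countable
  have hRT : R ⊨ diffTheory L' η := (i.theory_model_iff _).2 hmod
  obtain ⟨_, _, _, DR, hRT', rfl⟩ := exists_decomposition hRT
  let _ := deltaStructure (DR.1 : R → R)
  have := charZero_of_model hRT'
  obtain ⟨K, _, _, _, e, hK, hKc, hrank⟩ := exists_countable_extension_of_infinite_rank hbdd R hRT'
  obtain ⟨D', hD'⟩ := exists_derivation_of_subfield (fieldHom e.toEmbedding) DR.1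
  have hD'' : ∀ a, D' (e a) = e (DR.1 a) := hD'
  let D₀ : DerExt L' K η := ⟨D', derExt_of_embedding hRT' e DR hD''⟩
  have hfin : (e '' (i ⁻¹' s)).Finite :=
    (s.finite_toSet.preimage i.injective.injOn).image e
  obtain ⟨D₁, hD₁, hgen⟩ := (dense_iff_inter_open.1
    (isGδ_and_dense_genericTheory (η := η) hbdd hK hrank).2) _
    (isOpen_eq_on_finite hfin D₀) ⟨D₀, fun _ _ => rfl⟩
  have hext : ∀ r, Function.extend i e (fun _ => 0) (i r) = e r := fun r =>
    i.injective.extend_apply _ _ _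
  -- Outside the countable submodel the value 0 is arbitrary; nothing is claimed there.
  refine ⟨K, inferInstance, D₁.1, Function.extend i e (fun _ => 0), ⟨0⟩, hgen, ?_, ?_⟩
  · intro n φ x hx
    choose r hr using fun j => hs (hx j)
    obtain rfl : i ∘ r = x := funext hr
    rw [realize_fieldFormula_of_elementary (DR.1 : R → R) (D.1 : A → A) i φ r,
      ← e.map_formula φ r]
    rw [iff_iff_eq]
    congr 1
    funext j
    exact hext (r j)
  · intro a ha hδa
    obtain ⟨r, rfl⟩ := hs ha
    have h1 : i (DR.1 r) = D.1 (i r) :=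
      map_delta_of_embedding (DR.1 : R → R) (D.1 : A → A) i.toEmbedding r
    rw [← h1, hext, hext, hD₁ (e r) ⟨r, ha, rfl⟩]
    exact (hD'' r).symm

/-- Glue the finite approximations in an ultraproduct indexed by the finite subsets of A. By Łoś it
is generic, and each condition on A concerns finitely many elements, hence holds from some finite
set on. -/
theorem exists_embedding_genericTheory [Countable L'.Symbols] [CharZero M]
    (hbdd : AlgebraicallyBounded L' M) {A : Type} [(diffLang L').Structure A]
    (hA : A ⊨ diffTheory L' η) :
    ∃ B : Theory.ModelType.{0, 0, 0} (genericTheory η), Nonempty (A ↪[diffLang L'] B) := by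
  classical
  obtain ⟨_, _, _, D, hT, rfl⟩ := exists_decomposition hA
  choose K SK δ g hne hmod hφ hδ using exists_finite_approximation hbdd hT D
  let _ : ∀ s, (diffLang L').Structure (K s) := fun s =>
    @sumStructure (fieldLang L') deltaLang (K s) (SK s) (deltaStructure (δ s))
  let _ := deltaStructure (D.1 : A → A)
  let U : Ultrafilter (Finset A) := Ultrafilter.of Filter.atTop
  have hU : ∀ s : Finset A, ∀ᶠ t in (U : Filter (Finset A)), s ⊆ t := fun s =>
    Ultrafilter.of_le Filter.atTop (Filter.eventually_ge_atTop s)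
  let P := (U : Filter (Finset A)).Product K
  have hP : P ⊨ genericTheory η := by
    refine ⟨fun σ hσ => ?_⟩
    refine (Ultraproduct.sentence_realize σ).2 (Filter.Eventually.of_forall fun s => ?_)
    exact (hmod s).realize_of_mem σ hσ
  let G : A → P := fun a => ((fun s => g s a : ∀ s, K s) : P)
  have hG : ∀ (n : ℕ) (φ : (fieldLang L').Formula (Fin n)) (x : Fin n → A),
      ((LHom.sumInl : fieldLang L' →ᴸ diffLang L').onFormula φ).Realize (G ∘ x) ↔
        φ.Realize x := by
    intro n φ x
    refine (Ultraproduct.realize_formula_cast (u := U) (M := K)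
      ((LHom.sumInl : fieldLang L' →ᴸ diffLang L').onFormula φ) (fun i s => g s (x i))).trans ?_
    have h1 : ∀ᶠ s in (U : Filter (Finset A)),
        (((LHom.sumInl : fieldLang L' →ᴸ diffLang L').onFormula φ).Realize
          (fun i => g s (x i)) ↔ φ.Realize x) := by
      filter_upwards [hU (Finset.univ.image x)] with s hs
      let _ := deltaStructure (δ s)
      have h2 := hφ s n φ x (fun i => hs (Finset.mem_image_of_mem x (Finset.mem_univ i)))
      refine Iff.trans ?_ h2
      exact LHom.realize_onFormula (LHom.sumInl : fieldLang L' →ᴸ diffLang L') φ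
    rw [Filter.eventually_congr h1, Filter.eventually_const]
  have hinj : Function.Injective G := by
    intro a b hab
    have := (hG 2 (Term.equal (Term.var 0) (Term.var 1)) ![a, b]).1
    exact this hab
  have hPne : Nonempty P := ⟨G 0⟩
  let E : A ↪[diffLang L'] P :=
    { toFun := G
      inj' := hinj
      map_fun' := fun {n} f x => by
        rcases f with f | f
        -- Compatibility with a function symbol is preservation of its graph, a formula in one more
        -- variable.
        · have := (hG (n + 1) (Term.equal (Term.var (Fin.last n))
            (Term.func f (fun i => Term.var i.castSucc))) (Fin.snoc x (Structure.funMap f x))).2 (by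
              simp [Formula.realize_equal])
          have h3 : G ((Fin.snoc x (Structure.funMap f x) : Fin (n + 1) → A) (Fin.last n)) =
              Structure.funMap (L := diffLang L') (M := P) (Sum.inl f)
                (fun i => G ((Fin.snoc x (Structure.funMap f x) : Fin (n + 1) → A) i.castSucc)) :=
            this
          simp only [Fin.snoc_last, Fin.snoc_castSucc] at h3
          exact h3
        · cases f
          refine Eq.trans ?_ (Ultraproduct.funMap_cast (u := U) (M := K)
            (LHom.sumInr.onFunction deltaSymbol : (diffLang L').Functions 1)
            (fun i s => g s (x i))).symm
          refine Quotient.sound' ?_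
          change ∀ᶠ s in (U : Filter (Finset A)), g s (D.1 (x 0)) = δ s (g s (x 0))
          filter_upwards [hU {x 0, D.1 (x 0)}] with s hs
          exact hδ s _ (hs (by simp)) (hs (by simp))
      map_rel' := fun {n} r x => by
        rcases r with r | r
        · exact hG n (Relations.formula r (fun i => Term.var i)) x
        · exact Empty.elim r }
  exact ⟨Theory.ModelType.of _ P, ⟨E⟩⟩

end Embedding

/-! ### Formulas with finitely many variables -/

section FiniteVariables

/-- Only finitely many variables occur in φ. The set J₀ is included so that further prescribed
variables can be named alongside them. -/
theorem exists_formula_finite_right {L : FirstOrder.Language.{0, 0}} {α β : Type}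
    (φ : L.Formula (α ⊕ β)) (J₀ : Finset β) :
    ∃ J : Finset β, J₀ ⊆ J ∧ ∃ φ' : L.Formula (α ⊕ J), ∀ (N : Type) [L.Structure N] (v : α → N)
      (w : β → N), φ'.Realize (Sum.elim v (fun j => w j)) ↔ φ.Realize (Sum.elim v w) := by
  classical
  let J : Finset β := J₀ ∪ φ.freeVarFinset.toRight
  have hJ : ∀ b, Sum.inr b ∈ φ.freeVarFinset → b ∈ J := fun b hb =>
    Finset.mem_union_right _ (Finset.mem_toRight.2 hb)
  let f : φ.freeVarFinset → α ⊕ J := fun a => match a with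
    | ⟨Sum.inl a, _⟩ => Sum.inl a
    | ⟨Sum.inr b, hb⟩ => Sum.inr ⟨b, hJ b hb⟩
  refine ⟨J, Finset.subset_union_left, φ.restrictFreeVar f, fun N _ v w => ?_⟩
  refine BoundedFormula.realize_restrictFreeVar _ ?_
  rintro ⟨a | b, h⟩ <;> rfl

theorem exists_formula_fin_left {L : FirstOrder.Language.{0, 0}} {α β : Type}
    (φ : L.Formula (α ⊕ β)) :
    ∃ (m : ℕ) (q : Fin m → α) (φ' : L.Formula (Fin m ⊕ β)), ∀ (N : Type) [L.Structure N]
      (v : α → N) (w : β → N),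
      φ'.Realize (Sum.elim (fun i => v (q i)) w) ↔ φ.Realize (Sum.elim v w) := by
  obtain ⟨J, -, ψ, hψ⟩ := exists_formula_finite_right (φ.relabel Sum.swap) ∅
  refine ⟨J.card, fun i => (J.equivFin.symm i : α),
    ψ.relabel (Sum.elim Sum.inr (fun j => Sum.inl (J.equivFin j))), fun N _ v w => ?_⟩
  have h := hψ N w v
  rw [Formula.realize_relabel] at h ⊢
  convert h using 2
  · funext j
    rcases j with j | j
    · rfl
    · simp
  · funext j
    cases j <;> rfl

end FiniteVariables

/-! ### Extending embeddings into saturated generic models -/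

section Extension

variable {L' : FirstOrder.Language.{0, 0}} {M : Type} [Field M] [CompatibleRing M] [L'.Structure M]
  {η : Derivation ℤ (dclEmpty L' M) (dclEmpty L' M)}

theorem exists_solution_of_large {C : Type} [Field C] [CompatibleRing C] [L'.Structure C]
    {δ : C → C} (hC : ModelsWith δ (genericTheory η)) {α : Type} {n : ℕ}
    (θ : (fieldLang L').Formula (α ⊕ (Fin n ⊕ Fin n))) (p : α → C)
    (h : Large n {x | ∃ y : Fin n → C, θ.Realize (Sum.elim p (Sum.elim x y))}) :
    ∃ x, θ.Realize (Sum.elim p (Sum.elim x (δ ∘ x))) := by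
  obtain ⟨m, q, θ', hθ'⟩ := exists_formula_fin_left θ
  have := ((modelsWith_genericTheory_iff δ).1 hC).2 m n θ' (fun i => p (q i))
  simp only [hθ' C p] at this
  exact this h

theorem seqIndependent_of_independent {K : Type} [Field K] {E : Subfield K} {B : Set K}
    (hB : ∀ b ∈ B, b ∉ algCl E (B \ {b})) {n : ℕ} (x : Fin n → K) (hx : ∀ i, x i ∈ B)
    (hinj : Function.Injective x) : SeqIndependent E ∅ x := by
  intro i h
  refine hB _ (hx i) (algCl_mono E ?_ h)
  rw [Set.empty_union]
  rintro _ ⟨j, hj, rfl⟩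
  exact ⟨hx j, fun h => (ne_of_lt hj) (hinj h)⟩

theorem exists_basis {K : Type} [Field K] (E : Subfield K) :
    ∃ B : Set K, (∀ b ∈ B, b ∉ algCl E (B \ {b})) ∧ ∀ x, x ∈ algCl E B := by
  obtain ⟨B, hB⟩ := (AlgebraicIndependent.matroid E K).exists_isBase
  refine ⟨B, fun a ha => ?_, fun x => ?_⟩
  · rw [algCl_eq_closure]
    exact hB.indep.notMem_closure_sdiff_of_mem ha
  · rw [algCl_eq_closure, hB.closure_eq]
    exact Set.mem_univ x

theorem dclEmpty_subset_range {R R' : Type} [Field R'] [CompatibleRing R'] [L'.Structure R']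
    [(fieldLang L').Structure R] (i : R ↪ₑ[fieldLang L'] R') {x : R'} (hx : x ∈ dclEmpty L' R') :
    x ∈ Set.range i := by
  obtain ⟨φ, hφ⟩ := mem_dclEmpty_iff.1 hx
  have h : R ⊨ (fieldLang L').completeTheory R' := (i.theory_model_iff _).2 inferInstance
  obtain ⟨r, hr⟩ := (realize_existsUnique_iff h φ).2 ⟨x, hφ⟩
  exact ⟨r, (hφ _).1 ((i.map_formula φ (fun _ => r)).2 ((hr r).2 rfl))⟩

variable {R R' C : Type} [Field R] [CompatibleRing R] [L'.Structure R] [Field R']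
  [CompatibleRing R'] [L'.Structure R'] [Field C] [CompatibleRing C] [L'.Structure C]

/-- The finite part of the extension problem. The elements of B₀ are independent over R, so what ψ
says about them defines a large set. Largeness passes through R to C, where the generic axiom finds
a copy on which the derivation takes the required values. -/
theorem exists_partial_extension [Countable L'.Symbols] [Countable R]
    (hbdd : AlgebraicallyBounded L' M) (hR' : R' ⊨ (fieldLang L').completeTheory M)
    (i : R ↪ₑ[fieldLang L'] R') (g : R ↪ₑ[fieldLang L'] C) (δ' : R' → R') {δ : C → C}
    (hC : ModelsWith δ (genericTheory η)) {B : Set R'}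
    (hB : ∀ b ∈ B, b ∉ algCl (fieldHom i.toEmbedding).fieldRange (B \ {b})) {B₀ : Finset R'}
    (hB₀ : ↑B₀ ⊆ B) (ψ : (fieldLang L').Formula (R ⊕ R')) (hψ : ψ.Realize (Sum.elim i id)) :
    ∃ w : R' → C, ψ.Realize (Sum.elim g w) ∧ ∀ b ∈ B₀, w (δ' b) = δ (w b) := by
  classical
  obtain ⟨J, hJ, ψ', hψ'⟩ := exists_formula_finite_right ψ (B₀ ∪ B₀.image δ')
  let n := B₀.card
  let b : Fin n → R' := fun k => (B₀.equivFin.symm k : R')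
  have hbB₀ : ∀ k, b k ∈ B₀ := fun k => (B₀.equivFin.symm k).2
  have hbinj : Function.Injective b := Subtype.val_injective.comp B₀.equivFin.symm.injective
  have hb1 : ∀ k, b k ∈ J := fun k => hJ (Finset.mem_union_left _ (hbB₀ k))
  have hb2 : ∀ k, δ' (b k) ∈ J := fun k =>
    hJ (Finset.mem_union_right _ (Finset.mem_image_of_mem _ (hbB₀ k)))
  let V := (R ⊕ (Fin n ⊕ Fin n)) ⊕ J
  -- θ(x, y) says that ψ holds for some assignment giving B₀ the values x and its derivatives the
  -- values y.
  let θ : (fieldLang L').Formula (R ⊕ (Fin n ⊕ Fin n)) := Formula.iExs J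
    (ψ'.relabel (Sum.elim (fun r => Sum.inl (Sum.inl r)) Sum.inr : R ⊕ J → V) ⊓
      (Formula.iInf (fun k : Fin n => Term.equal (Term.var (Sum.inr ⟨b k, hb1 k⟩ : V))
        (Term.var (Sum.inl (Sum.inr (Sum.inl k))))) ⊓
       Formula.iInf (fun k : Fin n => Term.equal (Term.var (Sum.inr ⟨δ' (b k), hb2 k⟩ : V))
        (Term.var (Sum.inl (Sum.inr (Sum.inr k)))))))
  have hθ : ∀ (N : Type) [Field N] [CompatibleRing N] [L'.Structure N] (p : R → N)
      (x y : Fin n → N), θ.Realize (Sum.elim p (Sum.elim x y)) ↔ ∃ z : J → N,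
        ψ'.Realize (Sum.elim p z) ∧ (∀ k, z ⟨b k, hb1 k⟩ = x k) ∧
          ∀ k, z ⟨δ' (b k), hb2 k⟩ = y k := by
    intro N _ _ _ p x y
    simp only [θ, Formula.realize_iExs, Formula.realize_inf, Formula.realize_iInf,
      Formula.realize_relabel, Formula.realize_equal, Term.realize_var, Sum.elim_inl, Sum.elim_inr]
    refine exists_congr fun z => and_congr_left' ?_
    rw [iff_iff_eq]
    congr 1
    funext j
    cases j <;> rfl
  have hind : SeqIndependent (dclEmpty L' R') (Set.range i) b := by
    have h := seqIndependent_of_independent hB b (fun k => hB₀ (hbB₀ k)) hbinj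
    intro k hk
    refine h k ?_
    have hE : ((fieldHom i.toEmbedding).fieldRange : Set R') = Set.range i := by
      ext x
      simp
    have hset : (dclEmpty L' R' : Set R') ∪ (Set.range i ∪ b '' {j | j < k}) =
        ((fieldHom i.toEmbedding).fieldRange : Set R') ∪ (∅ ∪ b '' {j | j < k}) := by
      rw [hE, Set.empty_union, ← Set.union_assoc,
        Set.union_eq_right.2 (fun x hx => dclEmpty_subset_range i hx)]
    change IsAlgebraic (Subfield.closure _) _ at hk
    rw [hset] at hk
    exact hk
  have hreal : θ.Realize (Sum.elim i (Sum.elim b (δ' ∘ b))) :=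
    (hθ R' i b (δ' ∘ b)).2 ⟨fun j => j, (hψ' R' i id).2 hψ, fun _ => rfl, fun _ => rfl⟩
  have hlarge := large_of_seqIndependent hbdd hR' i n (projFormula θ) b
    ((realize_projFormula θ i b).2 ⟨_, hreal⟩) hind
  rw [← realize_largeFormula] at hlarge
  have h1 : (largeFormula n (projFormula θ)).Realize (g ∘ id) := by
    rw [g.map_formula, ← i.map_formula]
    exact hlarge
  rw [realize_largeFormula] at h1
  simp only [realize_projFormula] at h1
  obtain ⟨x, hx⟩ := exists_solution_of_large hC θ _ h1
  obtain ⟨z, hz1, hz2, hz3⟩ := (hθ C _ _ _).1 hx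
  -- Elements outside J do not occur in ψ or in the derivation conditions, so 0 is harmless.
  let w : R' → C := fun r => if h : r ∈ J then z ⟨r, h⟩ else 0
  have hw : (fun j : J => w j) = z := by
    funext j
    simp [w]
  refine ⟨w, ?_, ?_⟩
  · rw [← hψ', hw]
    exact hz1
  · intro c hc
    obtain ⟨k, rfl⟩ : ∃ k, b k = c := ⟨B₀.equivFin ⟨c, hc⟩, by simp [b]⟩
    rw [← hw] at hz2 hz3
    exact (hz3 k).trans (congrArg δ (hz2 k).symm)

/-- Saturation realizes in C the elementary diagram of R' over R together with the derivation
conditions on a transcendence basis B of R' over R. The conditions elsewhere follow, because R' is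
algebraic over R and B. -/
theorem exists_extension_of_elementary [Countable L'.Symbols] [Countable R] [Countable R']
    [CharZero M] (hbdd : AlgebraicallyBounded L' M) (hR' : R' ⊨ (fieldLang L').completeTheory M)
    (i : R ↪ₑ[fieldLang L'] R') (g : R ↪ₑ[fieldLang L'] C) (δR : R → R) (D' : DerExt L' R' η)
    (D : DerExt L' C η) (hi : ∀ r, i (δR r) = D'.1 (i r)) (hg : ∀ r, g (δR r) = D.1 (g r))
    (hC : ModelsWith (D.1 : C → C) (genericTheory η))
    (hsat : let _ := deltaStructure (D.1 : C → C); RealizesCountableTypes (diffLang L') C) :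
    ∃ g' : R' ↪ₑ[fieldLang L'] C, (∀ r, g' (i r) = g r) ∧ ∀ x, g' (D'.1 x) = D.1 (g' x) := by
  classical
  let _ := deltaStructure (D.1 : C → C)
  have := charZero_of_model hR'
  obtain ⟨B, hB, hBspan⟩ := exists_basis (fieldHom i.toEmbedding).fieldRange
  let P₁ : Set ((diffLang L').Formula (R ⊕ R')) := {χ | ∃ ψ : (fieldLang L').Formula (R ⊕ R'),
    ψ.Realize (Sum.elim i id) ∧ χ = (LHom.sumInl : fieldLang L' →ᴸ diffLang L').onFormula ψ}
  let P₂ : Set ((diffLang L').Formula (R ⊕ R')) := {χ | ∃ b ∈ B,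
    χ = Term.equal (Term.var (Sum.inr (D'.1 b))) (deltaTerm (Term.var (Sum.inr b)))}
  have hP₂ : ∀ (b : R') (w : R' → C), Formula.Realize (Term.equal (Term.var (Sum.inr (D'.1 b)))
      (deltaTerm (Term.var (Sum.inr b))) : (diffLang L').Formula (R ⊕ R')) (Sum.elim g w) ↔
      w (D'.1 b) = D.1 (w b) := by
    intro b w
    rw [Formula.realize_equal, realize_deltaTerm]
    rfl
  have : Countable ((diffLang L').Formula (R ⊕ R')) := countable_formula _ _
  -- A finite part of the type amounts to one formula ψ, by conjunction, and finitely many basis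
  -- elements.
  have hfin : ∀ s : Finset ((diffLang L').Formula (R ⊕ R')), ↑s ⊆ P₁ ∪ P₂ →
      ∃ (ψ : (fieldLang L').Formula (R ⊕ R')) (B₀ : Finset R'), ψ.Realize (Sum.elim i id) ∧
        ↑B₀ ⊆ B ∧ ∀ w : R' → C, ψ.Realize (Sum.elim g w) → (∀ b ∈ B₀, w (D'.1 b) = D.1 (w b)) →
          ∀ χ ∈ s, χ.Realize (Sum.elim g w) := by
    intro s
    induction s using Finset.induction_on with
    | empty => exact fun _ => ⟨⊤, ∅, Formula.realize_top.2 trivial, by simp, by simp⟩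
    | insert χ s _ ih =>
      intro hs
      rw [Finset.coe_insert, Set.insert_subset_iff] at hs
      obtain ⟨ψ, B₀, h1, h2, h3⟩ := ih hs.2
      rcases hs.1 with ⟨ψ', hψ', rfl⟩ | ⟨b, hb, rfl⟩
      · refine ⟨ψ ⊓ ψ', B₀, Formula.realize_inf.2 ⟨h1, hψ'⟩, h2, fun w hw hw' χ hχ => ?_⟩
        rw [Formula.realize_inf] at hw
        rcases Finset.mem_insert.1 hχ with rfl | hχ
        · exact (LHom.realize_onFormula _ _).2 hw.2
        · exact h3 w hw.1 hw' χ hχ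
      · refine ⟨ψ, insert b B₀, h1, ?_, fun w hw hw' χ hχ => ?_⟩
        · rw [Finset.coe_insert]
          exact Set.insert_subset hb h2
        · rcases Finset.mem_insert.1 hχ with rfl | hχ
          · exact (hP₂ b w).2 (hw' b (Finset.mem_insert_self _ _))
          · exact h3 w hw (fun c hc => hw' c (Finset.mem_insert_of_mem hc)) χ hχ
  obtain ⟨w, hw⟩ := hsat.exists_realize (P := P₁ ∪ P₂) (Set.to_countable _) g (fun s hs => by
    obtain ⟨ψ, B₀, h1, h2, h3⟩ := hfin s hs
    obtain ⟨w, hw1, hw2⟩ := exists_partial_extension hbdd hR' i g D'.1 hC hB h2 ψ h1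
    exact ⟨w, h3 w hw1 hw2⟩)
  have hw1 : ∀ ψ : (fieldLang L').Formula (R ⊕ R'), ψ.Realize (Sum.elim i id) →
      ψ.Realize (Sum.elim g w) := fun ψ hψ =>
    (LHom.realize_onFormula (LHom.sumInl : fieldLang L' →ᴸ diffLang L') ψ).1
      (hw _ (Or.inl ⟨ψ, hψ, rfl⟩))
  have hw2 : ∀ b ∈ B, w (D'.1 b) = D.1 (w b) := fun b hb =>
    (hP₂ b w).1 (hw _ (Or.inr ⟨b, hb, rfl⟩))
  have hw3 : ∀ r, w (i r) = g r := fun r => by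
    have := hw1 (Term.equal (Term.var (Sum.inr (i r))) (Term.var (Sum.inl r))) (by
      simp [Formula.realize_equal])
    simpa [Formula.realize_equal] using this
  have hw4 : ∀ (n : ℕ) (φ : (fieldLang L').Formula (Fin n)) (x : Fin n → R'), φ.Realize x →
      φ.Realize (w ∘ x) := fun n φ x hx => by
    have := hw1 (φ.relabel (fun k => Sum.inr (x k))) (by
      rw [Formula.realize_relabel]
      exact hx)
    rw [Formula.realize_relabel] at this
    exact this
  let g' : R' ↪ₑ[fieldLang L'] C :=
    { toFun := w
      map_formula' := fun n φ x => by
        refine ⟨fun h => ?_, hw4 n φ x⟩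
        by_contra hn
        exact (Formula.realize_not.1 (hw4 n φ.not x (Formula.realize_not.2 hn))) h }
  refine ⟨g', hw3, fun x => ?_⟩
  let h : R' →+* C := fieldHom g'.toEmbedding
  -- Both h ∘ D' and D ∘ h are derivations along h. They agree on the image of R and on B, hence
  -- everywhere.
  refine derivation_eq_of_isAlgebraic h (fun x => h (D'.1 x)) (fun x => D.1 (h x))
    (fun x y => by simp only [map_add]) (fun x y => by simp) (fun x y => by simp only [map_add])
    (fun x y => by simp) _ B ?_ (fun b hb => hw2 b hb) (hBspan x)
  rintro _ ⟨r, rfl⟩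
  change w (D'.1 (i r)) = D.1 (w (i r))
  rw [← hi, hw3, hw3, hg]

end Extension

/-! ### The model completion -/

section ModelCompletion

/-- An embedding between models of a model complete theory, as an elementary embedding. -/
def ModelComplete.elementaryEmbedding {L : FirstOrder.Language.{0, 0}} {T : L.Theory}
    (h : ModelComplete.{0, 0, 0} T) {A B : Type} [L.Structure A] [L.Structure B] [Nonempty A]
    [Nonempty B] (hA : A ⊨ T) (hB : B ⊨ T) (f : A ↪[L] B) : A ↪ₑ[L] B where
  toFun := f
  map_formula' n φ x := h (Theory.ModelType.of T A) (Theory.ModelType.of T B) f n φ x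

variable {L' : FirstOrder.Language.{0, 0}} {M : Type} [Field M] [CompatibleRing M] [L'.Structure M]
  {η : Derivation ℤ (dclEmpty L' M) (dclEmpty L' M)}

theorem infinite_of_model_diffTheory [CharZero M] {A : Type} [(diffLang L').Structure A]
    (hA : A ⊨ diffTheory L' η) : Infinite A := by
  obtain ⟨_, _, _, _, hT, rfl⟩ := exists_decomposition hA
  exact infinite_of_model hT

theorem model_diffTheory_of_genericTheory {A : Type} [(diffLang L').Structure A]
    (hA : A ⊨ genericTheory η) : A ⊨ diffTheory L' η :=
  (Theory.model_union_iff.1 hA).1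

theorem exists_extension_of_embedding [Countable L'.Symbols] [CharZero M]
    (hbdd : AlgebraicallyBounded L' M)
    (hmc : ModelComplete.{0, 0, 0} ((fieldLang L').completeTheory M)) {R R' C : Type}
    [(diffLang L').Structure R] [(diffLang L').Structure R'] [(diffLang L').Structure C]
    [Countable R] [Countable R'] (hR : R ⊨ diffTheory L' η) (hR' : R' ⊨ diffTheory L' η)
    (hC : C ⊨ genericTheory η) (hsat : RealizesCountableTypes (diffLang L') C)
    (j : R ↪[diffLang L'] R') (g : R ↪[diffLang L'] C) :
    ∃ g' : R' ↪[diffLang L'] C, ∀ r, g' (j r) = g r := by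
  obtain ⟨_, _, _, D₁, hT₁, rfl⟩ := exists_decomposition hR
  obtain ⟨_, _, _, D₂, hT₂, rfl⟩ := exists_decomposition hR'
  obtain ⟨_, _, _, D₃, hT₃, rfl⟩ := exists_decomposition (model_diffTheory_of_genericTheory hC)
  let i := hmc.elementaryEmbedding hT₁ hT₂ (reductEmbedding D₁.1 D₂.1 j)
  let f := hmc.elementaryEmbedding hT₁ hT₃ (reductEmbedding D₁.1 D₃.1 g)
  obtain ⟨g', h1, h2⟩ := exists_extension_of_elementary hbdd hT₂ i f D₁.1 D₂ D₃
    (map_delta_of_embedding (D₁.1 : R → R) (D₂.1 : R' → R') j)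
    (map_delta_of_embedding (D₁.1 : R → R) (D₃.1 : C → C) g) hC hsat
  exact ⟨diffEmbedding D₂.1 D₃.1 g'.toEmbedding h2, h1⟩

theorem exists_embedding_of_range_subset {L : FirstOrder.Language.{0, 0}} {A B C : Type}
    [L.Structure A] [L.Structure B] [L.Structure C] (f : A ↪[L] C) (i : B ↪[L] C)
    (h : Set.range f ⊆ Set.range i) : ∃ j : A ↪[L] B, ∀ a, i (j a) = f a := by
  choose j hj using fun a => h ⟨a, rfl⟩
  have hj' : ∀ {n : ℕ} (x : Fin n → A), i ∘ j ∘ x = f ∘ x := fun x => funext fun k => hj (x k)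
  exact ⟨{
    toFun := j
    inj' := fun a b hab => f.injective (by rw [← hj, hab, hj])
    map_fun' := fun s x => i.injective (by rw [hj, f.map_fun, i.map_fun, hj'])
    map_rel' := fun s x => by rw [← i.map_rel, hj', f.map_rel] }, hj⟩

/-- One step of the back-and-forth. The new element is absorbed into a countable elementary submodel
of C₁, so the domain stays a model of T^δ and model completeness continues to apply. -/
theorem exists_common_extension [Countable L'.Symbols] [CharZero M]
    (hbdd : AlgebraicallyBounded L' M)
    (hmc : ModelComplete.{0, 0, 0} ((fieldLang L').completeTheory M)) {C₁ C₂ R : Type}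
    [(diffLang L').Structure C₁] [(diffLang L').Structure C₂] [(diffLang L').Structure R]
    [Countable R] (hC₁ : C₁ ⊨ genericTheory η) (hC₂ : C₂ ⊨ genericTheory η)
    (hsat : RealizesCountableTypes (diffLang L') C₂) (hR : R ⊨ diffTheory L' η)
    (f₁ : R ↪[diffLang L'] C₁) (f₂ : R ↪[diffLang L'] C₂) (b : C₁) :
    ∃ (R' : Type) (_ : (diffLang L').Structure R') (j : R ↪[diffLang L'] R')
      (f₁' : R' ↪[diffLang L'] C₁) (f₂' : R' ↪[diffLang L'] C₂), Countable R' ∧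
      R' ⊨ diffTheory L' η ∧ (∀ r, f₁' (j r) = f₁ r) ∧ (∀ r, f₂' (j r) = f₂ r) ∧
      b ∈ Set.range f₁' := by
  have hC₁' := model_diffTheory_of_genericTheory hC₁
  have := infinite_of_model_diffTheory hC₁'
  obtain ⟨R', _, i, _, hi⟩ := exists_countable_elementaryEmbedding (diffLang L') C₁
    ((Set.countable_range f₁).insert b)
  have hR' : R' ⊨ diffTheory L' η := (i.theory_model_iff _).2 hC₁'
  obtain ⟨j, hj⟩ := exists_embedding_of_range_subset f₁ i.toEmbedding
    ((Set.subset_insert _ _).trans hi)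
  obtain ⟨f₂', hf₂'⟩ := exists_extension_of_embedding hbdd hmc hR hR' hC₂ hsat j f₂
  exact ⟨R', _, j, i.toEmbedding, f₂', ‹_›, hR', hj, hf₂', hi (Set.mem_insert _ _)⟩

/-- Induction on φ with the common countable submodel varying: at a quantifier, the challenged
element is added to the submodel by a back-and-forth step. -/
theorem realize_iff_of_embeddings [Countable L'.Symbols] [CharZero M]
    (hbdd : AlgebraicallyBounded L' M)
    (hmc : ModelComplete.{0, 0, 0} ((fieldLang L').completeTheory M)) {C₁ C₂ : Type}
    [(diffLang L').Structure C₁] [(diffLang L').Structure C₂]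
    (hC₁ : C₁ ⊨ genericTheory η) (hC₂ : C₂ ⊨ genericTheory η)
    (hsat₁ : RealizesCountableTypes (diffLang L') C₁)
    (hsat₂ : RealizesCountableTypes (diffLang L') C₂) {α : Type} {n : ℕ}
    (φ : (diffLang L').BoundedFormula α n) {R : Type} [(diffLang L').Structure R] [Countable R]
    (hR : R ⊨ diffTheory L' η) (f₁ : R ↪[diffLang L'] C₁) (f₂ : R ↪[diffLang L'] C₂)
    (v : α → R) (xs : Fin n → R) :
    φ.Realize (f₁ ∘ v) (f₁ ∘ xs) ↔ φ.Realize (f₂ ∘ v) (f₂ ∘ xs) := by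
  induction φ generalizing R with
  | falsum => rfl
  | equal =>
    simp only [BoundedFormula.Realize, ← Sum.comp_elim, HomClass.realize_term,
      EmbeddingLike.apply_eq_iff_eq]
  | rel r ts =>
    simp only [BoundedFormula.Realize, ← Sum.comp_elim, HomClass.realize_term]
    exact (f₁.map_rel r _).trans (f₂.map_rel r _).symm
  | imp _ _ ih1 ih2 =>
    rw [BoundedFormula.Realize, ih1 hR f₁ f₂, ih2 hR f₁ f₂, BoundedFormula.Realize]
  | all φ ih =>
    rw [BoundedFormula.Realize, BoundedFormula.Realize]
    constructor
    · intro h b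
      -- The challenge b lies in C₂ here, so the two models exchange roles and saturation of C₁ is
      -- used.
      obtain ⟨R', _, j, f₂', f₁', _, hR', h2, h1, c, rfl⟩ :=
        exists_common_extension hbdd hmc hC₂ hC₁ hsat₁ hR f₂ f₁ b
      have key := ih hR' f₁' f₂' (j ∘ v) (Fin.snoc (j ∘ xs) c)
      rw [Fin.comp_snoc, Fin.comp_snoc, ← Function.comp_assoc, ← Function.comp_assoc,
        ← Function.comp_assoc, ← Function.comp_assoc, show f₁' ∘ j = f₁ from funext h1,
        show f₂' ∘ j = f₂ from funext h2] at key
      exact key.1 (h _)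
    · intro h b
      obtain ⟨R', _, j, f₁', f₂', _, hR', h1, h2, c, rfl⟩ :=
        exists_common_extension hbdd hmc hC₁ hC₂ hsat₂ hR f₁ f₂ b
      have key := ih hR' f₁' f₂' (j ∘ v) (Fin.snoc (j ∘ xs) c)
      rw [Fin.comp_snoc, Fin.comp_snoc, ← Function.comp_assoc, ← Function.comp_assoc,
        ← Function.comp_assoc, ← Function.comp_assoc, show f₁' ∘ j = f₁ from funext h1,
        show f₂' ∘ j = f₂ from funext h2] at key
      exact key.2 (h _)

/-- For completeness, B and C are replaced by saturated elementary extensions and A by a countable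
elementary submodel containing the tuple. None of this changes the truth of φ. -/
theorem isModelCompletion_genericTheory [Countable L'.Symbols] [CharZero M]
    (hbdd : AlgebraicallyBounded L' M)
    (hmc : ModelComplete.{0, 0, 0} ((fieldLang L').completeTheory M)) :
    IsModelCompletion.{0, 0, 0} (diffTheory L' η) (genericTheory η) where
  model B := model_diffTheory_of_genericTheory B.is_model
  embeds A := exists_embedding_genericTheory hbdd A.is_model
  complete A B C f g n φ a := by
    obtain ⟨B', _, eB, hB⟩ := exists_elementaryEmbedding_realizesCountableTypes (diffLang L') B
    obtain ⟨C', _, eC, hC⟩ := exists_elementaryEmbedding_realizesCountableTypes (diffLang L') C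
    have := infinite_of_model_diffTheory A.is_model
    obtain ⟨R, _, i, _, hi⟩ := exists_countable_elementaryEmbedding (diffLang L') A
      (Set.countable_range a)
    choose r hr using fun k => hi ⟨k, rfl⟩
    obtain rfl : i ∘ r = a := funext hr
    have key := realize_iff_of_embeddings hbdd hmc ((eB.theory_model_iff _).1 B.is_model)
      ((eC.theory_model_iff _).1 C.is_model) hB hC φ ((i.theory_model_iff _).2 A.is_model)
      (eB.toEmbedding.comp (f.comp i.toEmbedding)) (eC.toEmbedding.comp (g.comp i.toEmbedding))
      r default
    rw [← eB.map_formula φ, ← eC.map_formula φ]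
    rw [Formula.Realize, Formula.Realize]
    convert key using 2 <;> rfl

/-- Model completeness of T lets θ be an arbitrary formula: the embedding is elementary on the
reducts, and it carries δx to δ of the image. -/
theorem realize_iExs_deltaFormula_of_embedding
    (hmc : ModelComplete.{0, 0, 0} ((fieldLang L').completeTheory M)) {A B : Type}
    [(diffLang L').Structure A] [(diffLang L').Structure B] (hA : A ⊨ diffTheory L' η)
    (hB : B ⊨ diffTheory L' η) (f : A ↪[diffLang L'] B) {α : Type} {n : ℕ}
    (θ : (fieldLang L').Formula (α ⊕ (Fin n ⊕ Fin n))) (p : α → A)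
    (h : (Formula.iExs (Fin n) (deltaFormula θ)).Realize p) :
    (Formula.iExs (Fin n) (deltaFormula θ)).Realize (f ∘ p) := by
  obtain ⟨_, _, _, D₁, hT₁, rfl⟩ := exists_decomposition hA
  obtain ⟨_, _, _, D₂, hT₂, rfl⟩ := exists_decomposition hB
  let _ := deltaStructure (D₁.1 : A → A)
  let _ := deltaStructure (D₂.1 : B → B)
  rw [Formula.realize_iExs] at h ⊢
  obtain ⟨x, hx⟩ := h
  refine ⟨f ∘ x, (realize_deltaFormula D₂.1 θ _ _).2 ?_⟩
  have h1 := (realize_deltaFormula D₁.1 θ _ _).1 hx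
  let e := hmc.elementaryEmbedding hT₁ hT₂ (reductEmbedding D₁.1 D₂.1 f)
  have h2 := (e.map_formula θ _).2 h1
  convert h2 using 1
  funext k
  rcases k with k | k | k
  · rfl
  · rfl
  · exact (map_delta_of_embedding (D₁.1 : A → A) (D₂.1 : B → B) f (x k)).symm

theorem realize_iExs_deltaFormula_of_large
    (hmc : ModelComplete.{0, 0, 0} ((fieldLang L').completeTheory M)) {A C : Type}
    [(diffLang L').Structure A] [(diffLang L').Structure C] (hA : A ⊨ diffTheory L' η)
    (hC : C ⊨ genericTheory η) (f : A ↪[diffLang L'] C) {m n : ℕ}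
    (θ : (fieldLang L').Formula (Fin m ⊕ (Fin n ⊕ Fin n))) (p : Fin m → A)
    (h : ((LHom.sumInl : fieldLang L' →ᴸ diffLang L').onFormula
      (largeFormula n (projFormula θ))).Realize p) :
    (Formula.iExs (Fin n) (deltaFormula θ)).Realize (f ∘ p) := by
  obtain ⟨_, _, _, D₁, hT₁, rfl⟩ := exists_decomposition hA
  obtain ⟨_, _, _, D₂, hT₂, rfl⟩ := exists_decomposition (model_diffTheory_of_genericTheory hC)
  let _ := deltaStructure (D₁.1 : A → A)
  let _ := deltaStructure (D₂.1 : C → C)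
  let e := hmc.elementaryEmbedding hT₁ hT₂ (reductEmbedding D₁.1 D₂.1 f)
  rw [LHom.realize_onFormula, ← e.map_formula, realize_largeFormula] at h
  simp only [realize_projFormula] at h
  obtain ⟨x, hx⟩ := ((modelsWith_genericTheory_iff _).1 hC).2 m n θ _ h
  exact Formula.realize_iExs.2 ⟨x, (realize_deltaFormula _ θ _ _).2 hx⟩

/-- Uniqueness of the model completion, in the form needed. Given a model K of some model
completion, embed K into a model C of `genericTheory` and C into a model B of that completion. The
axiom's solution exists in C, goes up to B, and comes back to K since K and B are equivalent over K.
-/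
theorem isGeneric_iff [Countable L'.Symbols] [CharZero M] (hbdd : AlgebraicallyBounded L' M)
    (hmc : ModelComplete.{0, 0, 0} ((fieldLang L').completeTheory M)) {K : Type} [Field K]
    [CompatibleRing K] [L'.Structure K] (hK : K ⊨ (fieldLang L').completeTheory M)
    (D : DerExt L' K η) : IsGeneric D ↔ ModelsWith (D.1 : K → K) (genericTheory η) := by
  refine ⟨?_, fun h => ⟨_, isModelCompletion_genericTheory hbdd hmc, h⟩⟩
  rintro ⟨T, hT, hDT⟩
  have hD : ModelsWith (D.1 : K → K) (diffTheory L' η) :=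
    (modelsWith_diffTheory_iff _).2 ⟨hK, D, rfl⟩
  refine (modelsWith_genericTheory_iff _).2 ⟨hD, fun m n θ p hlarge => ?_⟩
  simp only [← realize_projFormula] at hlarge
  let _ := deltaStructure (D.1 : K → K)
  obtain ⟨C, ⟨f⟩⟩ := exists_embedding_genericTheory hbdd hD
  have hC : C ⊨ diffTheory L' η := model_diffTheory_of_genericTheory C.is_model
  obtain ⟨B, ⟨g⟩⟩ := hT.embeds (Theory.ModelType.of _ C)
  have hexC : (Formula.iExs (Fin n) (deltaFormula θ)).Realize (f ∘ p) := by
    rw [← realize_largeFormula] at hlarge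
    exact realize_iExs_deltaFormula_of_large hmc hD C.is_model f θ p
      ((LHom.realize_onFormula _ _).2 hlarge)
  have hexB := realize_iExs_deltaFormula_of_embedding hmc hC (hT.model B) g θ _ hexC
  have hD' : K ⊨ diffTheory L' η := hD
  have hDT' : K ⊨ T := hDT
  -- K appears twice: as the common model of T^δ and, through the identity embedding, as a model of
  -- T.
  have hexK := (hT.complete (Theory.ModelType.of _ K) (Theory.ModelType.of T K) B
    (Embedding.refl _ K) (g.comp f) m _ p).2 hexB
  obtain ⟨x, hx⟩ := Formula.realize_iExs.1 hexK
  exact ⟨x, (realize_deltaFormula _ θ _ _).1 hx⟩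

end ModelCompletion

end GenericDerivation

/-! ### The main theorem -/

open GenericDerivation
theorem mainTheorem12 (L' : FirstOrder.Language.{0, 0}) [Countable L'.Symbols]
    (M : Type) [Field M] [CharZero M] [CompatibleRing M] [L'.Structure M]
    (hbdd : AlgebraicallyBounded L' M)
    (hmc : ModelComplete.{0, 0, 0} ((fieldLang L').completeTheory M))
    (η : Derivation ℤ (dclEmpty L' M) (dclEmpty L' M)) :
    (∃ (K : Type) (_ : Field K) (_ : CompatibleRing K) (_ : L'.Structure K),
      K ⊨ (fieldLang L').completeTheory M ∧ Countable K ∧ HasInfiniteRank L' K) ∧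
    ∀ (K : Type) [Field K] [CompatibleRing K] [L'.Structure K],
      K ⊨ (fieldLang L').completeTheory M → Countable K → HasInfiniteRank L' K →
        PolishSpace (DerExt L' K η) ∧
        IsGδ {D : DerExt L' K η | IsGeneric D} ∧
        Dense {D : DerExt L' K η | IsGeneric D} := by
  refine ⟨exists_countable_model_of_infinite_rank hbdd, fun K _ _ _ hK _ hrank => ?_⟩
  simp only [isGeneric_iff hbdd hmc hK]
  exact ⟨polishSpace_derExt, isGδ_and_dense_genericTheory hbdd hK hrank⟩
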